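/- **Programs.** Let $X$ and $Y$ be two type symbols. A program $\mathcal P$ consists of finitely many variables, each boolean, or of type $X$, or of type $Y$, or an array variable of type $X\to Y$, together with a finite set of guarded commands $e\longrightarrow I$. Boolean expressions are generated by $$e ::= \mathbf{true}\mid\mathbf{false}\mid b\mid x=x'\mid y=y'\mid \neg e\mid e\vee e ,$$ and $I$ is a simultaneous multiple assignment containing at most one assignment $b:=e$ for each boolean variable $b$; at most one of $x:=x'$, $x:=\,?$ (nondeterministic choice) for each variable $x$ of type $X$; at most one of $y:=y'$, $y:=\,?$, $y:=a[x]$ for each variable $y$ of type $Y$; and at most one write $a[x]:=y$ for each array $a$. (There is no array reset.) **Partial-functions semantics.** For sets $A^*,B^*$ instantiating $X,Y$, the transition system $[\![\mathcal P]\!]^*_{A^*,B^*}$ has as states the functions $s$ assigning to each boolean variable a truth value, to each variable of type $X$ (resp. $Y$) an element of $A^*$ (resp. $B^*$), and to each array variable $a$ a partial function $s(a)$ from $A^*$ to $B^*$ with finite domain that is defined at $s(x)$ for every variable $x$ of type $X$. Write $s(a)(v)=\bot$ if $s(a)$ is undefined at $v$. There is a transition from $s$ to $s'$ iff some guarded command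 $e\longrightarrow I$ of $\mathcal P$ is such that $e$ is true in $s$ and: * for each boolean or data variable $z$: if $z:=\,?$ is in $I$, then $s'(z)$ is unconstrained; if another assignment to $z$ is in $I$, then $s'(z)$ is the value of its right-hand side in $s$ (for $y:=a[x]$ this is $s(a)(s(x))$); otherwise $s'(z)=s(z)$; * for each array variable $a$ and each $v\in A^*$: if $I$ contains some $a[x]:=y$ with $s(x)=v$, then $s'(a)(v)=s(y)$; else, if there is no $x$ with $x:=\,?$ in $I$, $s'(x)=v$ and $s(a)(v)=\bot$, then $s'(a)(v)=s(a)(v)$ (both sides possibly $\bot$). The observables are the boolean variables; $b$ holds at $s$ iff $s(b)=\mathbf{true}$. **Formulas.** $\mu$-calculus formulas over the boolean variables are generated by $$\varphi::= p\mid\overline p\mid h\mid\varphi\vee\varphi\mid\varphi\wedge\varphi\mid\exists\bigcirc\varphi\mid\forall\bigcirc\varphi\mid\mu h:\varphi\mid\nu h:\varphi,$$ where $p$ ranges over the boolean variables and $h$ over fixpoint variables, with the usual semantics over transition systems ($\exists\bigcirc$, $\forall\bigcirc$: some, all successors; $\mu h:\varphi$, $\nu h:\varphi$: intersection, union of all sets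 $\tau$ of states with $\tau=[\![\varphi]\!]_{h\mapsto\tau}$). For closed $\varphi$, $\mathcal S,b_0\models\varphi$ means that $\varphi$ holds at every state of $\mathcal S$ at which $b_0$ holds. **Theorem.** Let $A^*$ and $B^*$ be any infinite sets. The following problem is decidable: given a program $\mathcal P$, a boolean variable $b_0$ of $\mathcal P$, and a closed $\mu$-calculus formula $\varphi$ over the boolean variables of $\mathcal P$, does $$[\![\mathcal P]\!]^*_{A^*,B^*},\,b_0\models\varphi$$ hold? Moreover, for every input $(\mathcal P,b_0,\varphi)$ the answer is independent of which infinite sets $A^*$ and $B^*$ are used. -/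

import Mathlib

/-! ## Transition systems and the modal mu-calculus -/

namespace ArrayMC

/-- A transition system over the observables `P`: states, successor function, and the set of
states at which each observable holds. -/
structure TransitionSystem (P : Type*) where
  Q : Type*
  δ : Q → Set Q
  ext : P → Set Q

/-- Formulas of the mu-calculus over the observables `P`, with fixpoint variables named by
natural numbers. There is no negation except on observables. -/
inductive Formula (P : Type*) where
  | obs (p : P)
  | nobs (p : P)
  | var (h : ℕ)
  | or (φ ψ : Formula P)
  | and (φ ψ : Formula P)
  | ex (φ : Formula P)
  | all (φ : Formula P)
  | mu (h : ℕ) (φ : Formula P)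
  | nu (h : ℕ) (φ : Formula P)

namespace Formula

variable {P : Type*}

/-- The fixpoint variables that occur free. -/
def free : Formula P → Set ℕ
  | obs _ => ∅
  | nobs _ => ∅
  | var h => {h}
  | or φ ψ => φ.free ∪ ψ.free
  | and φ ψ => φ.free ∪ ψ.free
  | ex φ => φ.free
  | all φ => φ.free
  | mu h φ => φ.free \ {h}
  | nu h φ => φ.free \ {h}

def Closed (φ : Formula P) : Prop := φ.free = ∅

/-- The set of states defined by a formula, relative to an assignment `E` of sets of states to
fixpoint variables. -/
def sem (S : TransitionSystem P) : Formula P → (ℕ → Set S.Q) → Set S.Q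
  | obs p, _ => S.ext p
  | nobs p, _ => (S.ext p)ᶜ
  | var h, E => E h
  | or φ ψ, E => φ.sem S E ∪ ψ.sem S E
  | and φ ψ, E => φ.sem S E ∩ ψ.sem S E
  | ex φ, E => {s | ∃ t ∈ S.δ s, t ∈ φ.sem S E}
  | all φ, E => {s | ∀ t ∈ S.δ s, t ∈ φ.sem S E}
  | mu h φ, E => ⋂₀ {τ | τ = φ.sem S (Function.update E h τ)}
  | nu h φ, E => ⋃₀ {τ | τ = φ.sem S (Function.update E h τ)}

end Formula

/-- Satisfaction of a formula at a state; for closed formulas the assignment is irrelevant. -/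
def TransitionSystem.SatAt {P : Type*} (S : TransitionSystem P) (s : S.Q) (φ : Formula P) : Prop :=
  ∀ E, s ∈ φ.sem S E

/-- `S, b₀ ⊨ φ`: the formula holds at every state at which the observable `b₀` holds. -/
def TransitionSystem.Sat {P : Type*} (S : TransitionSystem P) (b₀ : P) (φ : Formula P) : Prop :=
  ∀ s ∈ S.ext b₀, S.SatAt s φ

/-! ## Programs -/

/-- The variables of a program: `nb` booleans, `nx` of type `X`, `ny` of type `Y`, and `na` arrays
indexed by `X` with values in `Y`. The variables of each kind are named by the elements of
`Fin`. -/
structure Signature where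
  nb : ℕ
  nx : ℕ
  ny : ℕ
  na : ℕ

/-- Boolean expressions: the only test on values of type `X` or `Y` is equality of variables. -/
inductive BExp (σ : Signature) where
  | tt
  | ff
  | var (b : Fin σ.nb)
  | eqX (x x' : Fin σ.nx)
  | eqY (y y' : Fin σ.ny)
  | not (e : BExp σ)
  | or (e e' : BExp σ)

/-- Right-hand sides for variables of type `X`: `x := x'` and `x := ?`. -/
inductive XAssign (σ : Signature) where
  | copy (x' : Fin σ.nx)
  | any

/-- Right-hand sides for variables of type `Y`: `y := y'`, `y := ?` and `y := a[x]`. -/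
inductive YAssign (σ : Signature) where
  | copy (y' : Fin σ.ny)
  | any
  | read (a : Fin σ.na) (x : Fin σ.nx)

/-- A simultaneous multiple assignment: at most one assignment for each boolean and data variable,
and at most one write `a[x] := y`, given by `(x, y)`, for each array `a`. There is no
array reset. -/
structure Command (σ : Signature) where
  bool : Fin σ.nb → Option (BExp σ)
  dataX : Fin σ.nx → Option (XAssign σ)
  dataY : Fin σ.ny → Option (YAssign σ)
  write : Fin σ.na → Option (Fin σ.nx × Fin σ.ny)

/-- A guarded command `e ⟶ I`. -/
structure GuardedCommand (σ : Signature) where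
  guard : BExp σ
  body : Command σ

/-- A program: its variables and its finite set of guarded commands, presented as a list (neither
order nor multiplicity matters for the semantics). -/
structure Program where
  sig : Signature
  cmds : List (GuardedCommand sig)

/-! ## Partial-functions semantics -/

/-- States of the partial-functions semantics: arrays are finite partial functions (`none` means
undefined) that are defined at the current value of every variable of type `X`. -/
structure PFState (σ : Signature) (A B : Type*) where
  bool : Fin σ.nb → Bool
  dataX : Fin σ.nx → A
  dataY : Fin σ.ny → B
  arr : Fin σ.na → A → Option B
  arr_finite : ∀ a, {v | arr a v ≠ none}.Finite
  arr_defined : ∀ a x, arr a (dataX x) ≠ none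

section Semantics

variable {σ : Signature} {A B : Type*}

/-- `E_s(e) = true`. -/
def BExp.Holds (s : PFState σ A B) : BExp σ → Prop
  | tt => True
  | ff => False
  | var b => s.bool b = true
  | eqX x x' => s.dataX x = s.dataX x'
  | eqY y y' => s.dataY y = s.dataY y'
  | not e => ¬ e.Holds s
  | or e e' => e.Holds s ∨ e'.Holds s

/-- The effect on a boolean variable `b` of its assignment, if any. -/
def BoolStep (s s' : PFState σ A B) (b : Fin σ.nb) : Option (BExp σ) → Prop
  | some e => s'.bool b = true ↔ e.Holds s
  | none => s'.bool b = s.bool b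

/-- The effect on an `X`-variable `x` of its assignment, if any. -/
def XStep (s s' : PFState σ A B) (x : Fin σ.nx) : Option (XAssign σ) → Prop
  | some (.copy x') => s'.dataX x = s.dataX x'
  | some .any => True
  | none => s'.dataX x = s.dataX x

/-- The effect on a `Y`-variable `y` of its assignment, if any. A read `y := a[x]` always finds the
array defined at `x`. -/
def YStep (s s' : PFState σ A B) (y : Fin σ.ny) : Option (YAssign σ) → Prop
  | some (.copy y') => s'.dataY y = s.dataY y'
  | some .any => True
  | some (.read a x) => some (s'.dataY y) = s.arr a (s.dataX x)
  | none => s'.dataY y = s.dataY y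

/-- The effect on the array `a` at the index `v`: a write to `a` at `v` takes effect; otherwise the
entry is unchanged, unless it was undefined and `v` is selected by some `x := ?`, in which case
the new entry is unconstrained. -/
def ArrStep (I : Command σ) (s s' : PFState σ A B) (a : Fin σ.na) (v : A) : Prop :=
  (∀ x y, I.write a = some (x, y) → s.dataX x = v → s'.arr a v = some (s.dataY y)) ∧
  ((¬ ∃ x y, I.write a = some (x, y) ∧ s.dataX x = v) →
    (¬ ∃ x, I.dataX x = some .any ∧ s'.dataX x = v ∧ s.arr a v = none) →
      s'.arr a v = s.arr a v)

/-- The transition relation of a multiple assignment in the partial-functions semantics. -/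
def Command.Step (I : Command σ) (s s' : PFState σ A B) : Prop :=
  (∀ b, BoolStep s s' b (I.bool b)) ∧
  (∀ x, XStep s s' x (I.dataX x)) ∧
  (∀ y, YStep s s' y (I.dataY y)) ∧
  (∀ a v, ArrStep I s s' a v)

end Semantics

/-- The partial-functions semantics of a program, with `X` and `Y` instantiated to `A` and `B`; the
observables are the boolean variables. -/
def Program.pfSem (p : Program) (A B : Type*) : TransitionSystem (Fin p.sig.nb) where
  Q := PFState p.sig A B
  δ s := {s' | ∃ c ∈ p.cmds, c.guard.Holds s ∧ c.body.Step s s'}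
  ext b := {s | s.bool b = true}

/-! ## The model-checking problem and its decidability -/

/-- Inputs of the model-checking problem: a program, one of its boolean variables, and a closed
formula over its boolean variables. -/
structure Problem where
  prog : Program
  b₀ : Fin prog.sig.nb
  φ : Formula (Fin prog.sig.nb)
  closed : φ.Closed

/-- The question asked about an input, for given instances of `X` and `Y`. -/
def Problem.Holds (i : Problem) (A B : Type*) : Prop :=
  (i.prog.pfSem A B).Sat i.b₀ i.φ

/-! The inputs are presented to algorithms through a standard structural Gödel numbering. -/

def BExp.code {σ : Signature} : BExp σ → ℕ
  | tt => Nat.pair 0 0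
  | ff => Nat.pair 1 0
  | var b => Nat.pair 2 b
  | eqX x x' => Nat.pair 3 (Nat.pair x x')
  | eqY y y' => Nat.pair 4 (Nat.pair y y')
  | not e => Nat.pair 5 e.code
  | or e e' => Nat.pair 6 (Nat.pair e.code e'.code)

def Formula.code {n : ℕ} : Formula (Fin n) → ℕ
  | obs p => Nat.pair 0 p
  | nobs p => Nat.pair 1 p
  | var h => Nat.pair 2 h
  | or φ ψ => Nat.pair 3 (Nat.pair φ.code ψ.code)
  | and φ ψ => Nat.pair 4 (Nat.pair φ.code ψ.code)
  | ex φ => Nat.pair 5 φ.code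
  | all φ => Nat.pair 6 φ.code
  | mu h φ => Nat.pair 7 (Nat.pair h φ.code)
  | nu h φ => Nat.pair 8 (Nat.pair h φ.code)

def XAssign.code {σ : Signature} : XAssign σ → ℕ
  | copy x' => Nat.pair 0 x'
  | any => Nat.pair 1 0

def YAssign.code {σ : Signature} : YAssign σ → ℕ
  | copy y' => Nat.pair 0 y'
  | any => Nat.pair 1 0
  | read a x => Nat.pair 2 (Nat.pair a x)

/-- A finite family of optional objects is coded by the list of its entries, `none` as `0`. -/
def codeFamily {n : ℕ} {α : Type*} (c : α → ℕ) (f : Fin n → Option α) : ℕ :=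
  Encodable.encode (List.ofFn fun k => (f k).elim 0 fun t => c t + 1)

def Command.code {σ : Signature} (I : Command σ) : ℕ :=
  Encodable.encode
    [codeFamily BExp.code I.bool, codeFamily XAssign.code I.dataX,
     codeFamily YAssign.code I.dataY, codeFamily (fun w => Nat.pair w.1 w.2) I.write]

def GuardedCommand.code {σ : Signature} (c : GuardedCommand σ) : ℕ :=
  Nat.pair c.guard.code c.body.code

def Program.code (p : Program) : ℕ :=
  Encodable.encode
    [p.sig.nb, p.sig.nx, p.sig.ny, p.sig.na,
     Encodable.encode (p.cmds.map GuardedCommand.code)]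

def Problem.code (i : Problem) : ℕ :=
  Encodable.encode [i.prog.code, (i.b₀ : ℕ), i.φ.code]

/-- A yes-no question about inputs of the model-checking problem is decidable if some total
computable procedure on codes answers it correctly on every input. -/
def DecidableProblem (R : Problem → Prop) : Prop :=
  ∃ f : ℕ → Bool, Computable f ∧ ∀ i : Problem, f i.code = true ↔ R i

end ArrayMC

/-!
A program in the partial-functions semantics can only observe the *view* of a state: its booleans,
the values of its variables of type `X`, and the values of the terms `y` and `a[x]` of type `Y`;
and of the values it can only observe which are equal. The array entries outside the current
indices do not matter, although `x := ?` may return to an index at which they are stored: over an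
infinite set it may as well choose an index at which all arrays are undefined, and there the new
entries are unconstrained. Hence (`PFState.exists_step`) every step between views whose new
indices are fresh lifts to a step of states. Since a step of views depends only on
the joint equality pattern of its two ends (`View.Step.congr`), and patterns can be copied wherever
there are enough unused values (`View.exists_step_copy`), taking the equality pattern of the view is
a functional bisimulation to a transition system that mentions neither set
(`Program.isBisimMap_pfSem`). Formulas of the mu-calculus are invariant under functional
bisimulations (`IsBisimMap.mem_sem`), so the answer does not depend on the sets.

For decidability, views are coded by digits in a base with room for twice the number of values
in a view; numbers below a computable bound then form a finite system with the same patterns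
(`Input.isBisimMap_system`). Over it, the sets of states and the assignments of sets to fixpoint
variables are bit vectors, so that the fixpoint clauses of the semantics become bounded
quantifiers, and truth of a formula is defined by course-of-values recursion on its code, uniformly
in the assignment and the state (`Input.sem`, `Input.sem_code`). The resulting predicate
`Input.Accepts` on codes of inputs is primitive recursive.
-/

/-! ### Invariance of the mu-calculus under functional bisimulations -/

namespace ArrayMC

namespace Formula

variable {P : Type*}

theorem sInter_fixedPoints {X : Type*} {F : Set X → Set X} (hF : Monotone F) :
    ⋂₀ {τ | τ = F τ} = OrderHom.lfp ⟨F, hF⟩ := by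
  apply subset_antisymm
  · exact Set.sInter_subset_of_mem (OrderHom.map_lfp ⟨F, hF⟩).symm
  · exact Set.subset_sInter fun τ (hτ : τ = F τ) => OrderHom.lfp_le ⟨F, hF⟩ hτ.symm.subset

theorem sUnion_fixedPoints {X : Type*} {F : Set X → Set X} (hF : Monotone F) :
    ⋃₀ {τ | τ = F τ} = OrderHom.gfp ⟨F, hF⟩ := by
  apply subset_antisymm
  · exact Set.sUnion_subset fun τ (hτ : τ = F τ) => OrderHom.le_gfp ⟨F, hF⟩ hτ.subset
  · exact Set.subset_sUnion_of_mem (OrderHom.map_gfp ⟨F, hF⟩).symm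

theorem update_subset_update {X : Type*} {E E' : ℕ → Set X} (hE : ∀ h, E h ⊆ E' h)
    (h : ℕ) {τ τ' : Set X} (hτ : τ ⊆ τ') (k : ℕ) :
    Function.update E h τ k ⊆ Function.update E' h τ' k := by
  by_cases hk : k = h
  · subst hk; simpa using hτ
  · simpa [hk] using hE k

theorem sem_mono (S : TransitionSystem P) (φ : Formula P) :
    ∀ {E E' : ℕ → Set S.Q}, (∀ h, E h ⊆ E' h) → φ.sem S E ⊆ φ.sem S E' := by
  induction φ with
  | obs p => intros; exact subset_rfl
  | nobs p => intros; exact subset_rfl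
  | var h => intro E E' H; exact H h
  | or φ ψ ih₁ ih₂ => intro E E' H; exact Set.union_subset_union (ih₁ H) (ih₂ H)
  | and φ ψ ih₁ ih₂ => intro E E' H; exact Set.inter_subset_inter (ih₁ H) (ih₂ H)
  | ex φ ih => rintro E E' H s ⟨t, ht, h⟩; exact ⟨t, ht, ih H h⟩
  | all φ ih => intro E E' H s h t ht; exact ih H (h t ht)
  | mu h φ ih =>
    intro E E' H
    have mono : ∀ E : ℕ → Set S.Q, Monotone fun τ => φ.sem S (Function.update E h τ) :=
      fun E _ _ hτ => ih (update_subset_update (fun _ => subset_rfl) h hτ)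
    simp only [sem]
    rw [sInter_fixedPoints (mono E), sInter_fixedPoints (mono E')]
    exact OrderHom.lfp.mono fun τ => ih (update_subset_update H h subset_rfl)
  | nu h φ ih =>
    intro E E' H
    have mono : ∀ E : ℕ → Set S.Q, Monotone fun τ => φ.sem S (Function.update E h τ) :=
      fun E _ _ hτ => ih (update_subset_update (fun _ => subset_rfl) h hτ)
    simp only [sem]
    rw [sUnion_fixedPoints (mono E), sUnion_fixedPoints (mono E')]
    exact OrderHom.gfp.mono fun τ => ih (update_subset_update H h subset_rfl)

theorem monotone_sem_update (S : TransitionSystem P) (φ : Formula P) (E : ℕ → Set S.Q) (h : ℕ) :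
    Monotone fun τ => φ.sem S (Function.update E h τ) :=
  fun _ _ hτ => φ.sem_mono S (update_subset_update (fun _ => subset_rfl) h hτ)

theorem sem_congr_free (S : TransitionSystem P) (φ : Formula P) :
    ∀ {E E' : ℕ → Set S.Q}, (∀ h ∈ φ.free, E h = E' h) → φ.sem S E = φ.sem S E' := by
  induction φ with
  | obs p => intros; rfl
  | nobs p => intros; rfl
  | var h => intro E E' H; exact H h rfl
  | or φ ψ ih₁ ih₂ =>
    intro E E' H
    simp only [sem]
    rw [ih₁ fun h hh => H h (Or.inl hh), ih₂ fun h hh => H h (Or.inr hh)]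
  | and φ ψ ih₁ ih₂ =>
    intro E E' H
    simp only [sem]
    rw [ih₁ fun h hh => H h (Or.inl hh), ih₂ fun h hh => H h (Or.inr hh)]
  | ex φ ih => intro E E' H; simp only [sem]; rw [ih H]
  | all φ ih => intro E E' H; simp only [sem]; rw [ih H]
  | mu h φ ih =>
    intro E E' H
    have key : ∀ τ, φ.sem S (Function.update E h τ) = φ.sem S (Function.update E' h τ) := by
      intro τ
      refine ih fun k hk => ?_
      by_cases hkh : k = h
      · subst hkh; simp
      · simpa [hkh] using H k ⟨hk, hkh⟩
    simp only [sem, key]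
  | nu h φ ih =>
    intro E E' H
    have key : ∀ τ, φ.sem S (Function.update E h τ) = φ.sem S (Function.update E' h τ) := by
      intro τ
      refine ih fun k hk => ?_
      by_cases hkh : k = h
      · subst hkh; simp
      · simpa [hkh] using H k ⟨hk, hkh⟩
    simp only [sem, key]

end Formula

theorem TransitionSystem.satAt_iff {P : Type*} (S : TransitionSystem P) {φ : Formula P}
    (hφ : φ.Closed) (E : ℕ → Set S.Q) (s : S.Q) : S.SatAt s φ ↔ s ∈ φ.sem S E := by
  refine ⟨fun h => h E, fun h E' => ?_⟩
  rwa [φ.sem_congr_free S (E := E') (E' := E) (by rw [hφ]; simp)]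

/-- A functional bisimulation: a map of states that preserves and reflects observables, and along
which steps can be both pushed forward and lifted. -/
structure IsBisimMap {P : Type*} (S T : TransitionSystem P) (f : S.Q → T.Q) : Prop where
  ext_iff : ∀ p s, f s ∈ T.ext p ↔ s ∈ S.ext p
  push : ∀ {s s'}, s' ∈ S.δ s → f s' ∈ T.δ (f s)
  lift : ∀ {s t}, t ∈ T.δ (f s) → ∃ s' ∈ S.δ s, f s' = t

/-- The mu-calculus is invariant under functional bisimulations. -/
theorem IsBisimMap.mem_sem {P : Type*} {S T : TransitionSystem P} {f : S.Q → T.Q}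
    (hf : IsBisimMap S T f) (φ : Formula P) :
    ∀ D : ℕ → Set T.Q, φ.sem S (fun h => f ⁻¹' D h) = f ⁻¹' φ.sem T D := by
  -- Updating an assignment pulled back along `f` by a pulled back set.
  have upd : ∀ (D : ℕ → Set T.Q) h U, Function.update (fun k => f ⁻¹' D k) h (f ⁻¹' U) =
      fun k => f ⁻¹' (Function.update D h U k) := by
    intro D h U
    funext k
    by_cases hk : k = h
    · subst hk; simp
    · simp [hk]
  induction φ with
  | obs p => intro D; ext s; exact (hf.ext_iff p s).symm
  | nobs p => intro D; ext s; exact not_congr (hf.ext_iff p s).symm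
  | var h => intro D; rfl
  | or φ ψ ih₁ ih₂ => intro D; simp only [Formula.sem, ih₁, ih₂, Set.preimage_union]
  | and φ ψ ih₁ ih₂ => intro D; simp only [Formula.sem, ih₁, ih₂, Set.preimage_inter]
  | ex φ ih =>
    intro D
    simp only [Formula.sem, ih]
    ext s
    constructor
    · rintro ⟨s', hs, h⟩
      exact ⟨f s', hf.push hs, h⟩
    · rintro ⟨t, ht, h⟩
      obtain ⟨s', hs, rfl⟩ := hf.lift ht
      exact ⟨s', hs, h⟩
  | all φ ih =>
    intro D
    simp only [Formula.sem, ih]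
    ext s
    constructor
    · intro h t ht
      obtain ⟨s', hs, rfl⟩ := hf.lift ht
      exact h s' hs
    · intro h s' hs
      exact h (f s') (hf.push hs)
  | mu h φ ih =>
    intro D
    have monoS := φ.monotone_sem_update S (fun k => f ⁻¹' D k) h
    have monoT := φ.monotone_sem_update T D h
    have comm : ∀ U, φ.sem S (Function.update (fun k => f ⁻¹' D k) h (f ⁻¹' U)) =
        f ⁻¹' φ.sem T (Function.update D h U) := fun U => by rw [upd, ih]
    simp only [Formula.sem]
    rw [Formula.sInter_fixedPoints monoS, Formula.sInter_fixedPoints monoT]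
    apply subset_antisymm
    · refine OrderHom.lfp_le _ ?_
      change φ.sem S _ ⊆ _
      rw [comm]
      exact Set.preimage_mono (OrderHom.map_lfp ⟨_, monoT⟩).subset
    · -- The largest set of states of `T` whose preimage lies in the fixpoint is a prefixpoint.
      set τ := OrderHom.lfp ⟨_, monoS⟩ with hτ
      have hsub : OrderHom.lfp ⟨_, monoT⟩ ⊆ {t | ∀ s, f s = t → s ∈ τ} := by
        refine OrderHom.lfp_le _ ?_
        rintro t ht s rfl
        rw [hτ, ← OrderHom.map_lfp]
        refine monoS (a := f ⁻¹' {t | ∀ s, f s = t → s ∈ τ}) (fun s hs => hs s rfl) ?_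
        change s ∈ φ.sem S _
        rw [comm]
        exact ht
      exact fun s hs => hsub hs s rfl
  | nu h φ ih =>
    intro D
    have monoS := φ.monotone_sem_update S (fun k => f ⁻¹' D k) h
    have monoT := φ.monotone_sem_update T D h
    have comm : ∀ U, φ.sem S (Function.update (fun k => f ⁻¹' D k) h (f ⁻¹' U)) =
        f ⁻¹' φ.sem T (Function.update D h U) := fun U => by rw [upd, ih]
    simp only [Formula.sem]
    rw [Formula.sUnion_fixedPoints monoS, Formula.sUnion_fixedPoints monoT]
    apply subset_antisymm
    · -- The image of the fixpoint is a postfixpoint.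
      set τ := OrderHom.gfp ⟨_, monoS⟩ with hτ
      have hsub : f '' τ ⊆ OrderHom.gfp ⟨_, monoT⟩ := by
        refine OrderHom.le_gfp _ ?_
        rintro _ ⟨s, hs, rfl⟩
        rw [hτ, ← OrderHom.map_gfp] at hs
        have := monoS (b := f ⁻¹' (f '' τ)) (Set.subset_preimage_image f τ) hs
        change s ∈ φ.sem S _ at this
        rw [comm] at this
        exact this
      exact fun s hs => hsub ⟨s, hs, rfl⟩
    · refine OrderHom.le_gfp _ ?_
      change _ ⊆ φ.sem S _
      rw [comm]
      exact Set.preimage_mono (OrderHom.map_gfp ⟨_, monoT⟩).symm.subset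

end ArrayMC

/-! ### Equality patterns of families -/

namespace ArrayMC

/-- Two families indexed by `I` have the same equality pattern. -/
def SameKer {I α α' : Type*} (u : I → α) (w : I → α') : Prop :=
  ∀ i j, u i = u j ↔ w i = w j

theorem exists_injective_mem_finset {J α : Type*} [Fintype J] {G : Finset α}
    (h : Fintype.card J ≤ G.card) : ∃ e : J → α, Function.Injective e ∧ ∀ j, e j ∈ G := by
  obtain ⟨e⟩ := Function.Embedding.nonempty_of_card_le (α := J) (β := G) (by simpa using h)
  exact ⟨fun j => e j, fun i j h => e.injective (Subtype.ext h), fun j => (e j).2⟩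

theorem exists_injective_notMem {J α : Type*} [Finite J] [Infinite α] {F : Set α}
    (hF : F.Finite) : ∃ e : J → α, Function.Injective e ∧ ∀ j, e j ∉ F := by
  have := Fintype.ofFinite J
  obtain ⟨G, hG, hcard⟩ := hF.infinite_compl.exists_subset_card_eq (Fintype.card J)
  obtain ⟨e, he, heG⟩ := exists_injective_mem_finset (J := J) (G := G) hcard.ge
  exact ⟨e, he, fun j => hG (heG j)⟩

theorem exists_injective_lt {J : Type*} [Fintype J] (w : J → ℕ) {n : ℕ}
    (h : 2 * Fintype.card J ≤ n) :
    ∃ e : J → ℕ, Function.Injective e ∧ ∀ j, e j < n ∧ e j ∉ Set.range w := by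
  classical
  have hcard : Fintype.card J ≤ (Finset.range n \ Finset.univ.image w).card := by
    have h1 := Finset.le_card_sdiff (Finset.univ.image w) (Finset.range n)
    have h2 : (Finset.univ.image w).card ≤ Fintype.card J := Finset.card_image_le
    rw [Finset.card_range] at h1
    omega
  obtain ⟨e, he, heG⟩ := exists_injective_mem_finset hcard
  exact ⟨e, he, fun j => by simpa using heG j⟩

/-- If `w` copies the equality pattern of `u`, then every extension of `u` by a second family can
be copied as well, taking the values required to be new from a reservoir `e` of values not in
`w`. -/
theorem SameKer.extend {I J α α' : Type*} {u : I → α} {w : I → α'} (h : SameKer u w) (u' : J → α)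
    {e : J → α'} (he : Function.Injective e) (hew : ∀ j, e j ∉ Set.range w) :
    ∃ w' : J → α', SameKer (Sum.elim u u') (Sum.elim w w') ∧
      ∀ j, w' j ∈ Set.range w ∨ w' j ∈ Set.range e := by
  classical
  -- A representative of `j` that depends only on `u' j`.
  let r : J → J := fun j => Set.rangeSplitting u' ⟨u' j, j, rfl⟩
  have hr : ∀ j, u' (r j) = u' j := fun j => Set.apply_rangeSplitting u' _
  have hr' : ∀ i j, u' i = u' j ↔ r i = r j := fun i j =>
    ⟨fun hij => by simp only [r, hij], fun hij => by rw [← hr i, hij, hr]⟩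
  let w' : J → α' := fun j => if hj : ∃ i, u i = u' j then w hj.choose else e (r j)
  have old : ∀ i j, u i = u' j → w' j = w i := by
    intro i j hij
    have hj : ∃ i, u i = u' j := ⟨i, hij⟩
    simp only [w', dif_pos hj]
    exact (h _ _).1 (hj.choose_spec.trans hij.symm)
  have new : ∀ j, (¬ ∃ i, u i = u' j) → w' j = e (r j) := fun j hj => dif_neg hj
  have cross : ∀ i j, u i = u' j ↔ w i = w' j := by
    intro i j
    refine ⟨fun hij => (old i j hij).symm, fun hij => ?_⟩
    by_cases hj : ∃ k, u k = u' j
    · obtain ⟨k, hk⟩ := hj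
      rw [old k j hk] at hij
      exact ((h _ _).2 hij).trans hk
    · exact absurd ⟨i, hij.trans (new j hj)⟩ (hew (r j))
  refine ⟨w', ?_, fun j => ?_⟩
  · rintro (i | i) (j | j)
    · exact h i j
    · exact cross i j
    · exact eq_comm.trans ((cross j i).trans eq_comm)
    · change u' i = u' j ↔ w' i = w' j
      by_cases hj : ∃ k, u k = u' j
      · obtain ⟨k, hk⟩ := hj
        rw [old k j hk, ← hk]
        exact eq_comm.trans ((cross k i).trans eq_comm)
      · by_cases hi : ∃ k, u k = u' i
        · obtain ⟨k, hk⟩ := hi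
          rw [old k i hk, ← hk]
          exact cross k j
        · rw [new i hi, new j hj, he.eq_iff, hr']
  · by_cases hj : ∃ k, u k = u' j
    · obtain ⟨k, hk⟩ := hj
      exact Or.inl ⟨k, (old k j hk).symm⟩
    · exact Or.inr ⟨r j, (new j hj).symm⟩

theorem exists_sameKer {J α α' : Type*} (u : J → α) {e : J → α'} (he : Function.Injective e) :
    ∃ w : J → α', SameKer u w ∧ ∀ j, w j ∈ Set.range e := by
  have h0 : SameKer (fun i : Empty => (i.elim : α)) (fun i : Empty => (i.elim : α')) :=
    fun i => i.elim
  obtain ⟨w, hw, hwe⟩ := h0.extend u he (fun j => by simp)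
  exact ⟨w, fun i j => hw (Sum.inr i) (Sum.inr j), fun j => (hwe j).resolve_left (by simp)⟩

/-! ### Views of states and their steps -/

/-- The terms of type `Y` that name a value in a state: the variables and the array entries
`a[x]`. -/
abbrev YTerm (σ : Signature) : Type := Fin σ.ny ⊕ Fin σ.na × Fin σ.nx

/-- The part of a state accessible to the program: the booleans, the values of the variables of
type `X`, and the values of the terms of type `Y`. -/
@[ext]
structure View (σ : Signature) (α β : Type*) where
  bool : Fin σ.nb → Bool
  dataX : Fin σ.nx → α
  term : YTerm σ → β

namespace View

variable {σ : Signature} {α β α' β' : Type*}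

/-- Truth of a boolean expression. -/
def Holds (v : View σ α β) : BExp σ → Prop
  | .tt => True
  | .ff => False
  | .var b => v.bool b = true
  | .eqX x x' => v.dataX x = v.dataX x'
  | .eqY y y' => v.term (.inl y) = v.term (.inl y')
  | .not e => ¬ v.Holds e
  | .or e e' => v.Holds e ∨ v.Holds e'

def BoolStep (v v' : View σ α β) (b : Fin σ.nb) : Option (BExp σ) → Prop
  | some e => v'.bool b = true ↔ v.Holds e
  | none => v'.bool b = v.bool b

def XStep (v v' : View σ α β) (x : Fin σ.nx) : Option (XAssign σ) → Prop
  | some (.copy x') => v'.dataX x = v.dataX x'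
  | some .any => True
  | none => v'.dataX x = v.dataX x

def YStep (v v' : View σ α β) (y : Fin σ.ny) : Option (YAssign σ) → Prop
  | some (.copy y') => v'.term (.inl y) = v.term (.inl y')
  | some .any => True
  | some (.read a x) => v'.term (.inl y) = v.term (.inr (a, x))
  | none => v'.term (.inl y) = v.term (.inl y)

/-- The effect on the entry `a[x']`, where `x'` takes its new value. The entry is unconstrained
if the new value of `x'` is the old value of no variable. -/
def ArrStep (I : Command σ) (v v' : View σ α β) (a : Fin σ.na) (x' : Fin σ.nx) : Prop :=
  (∀ x y, I.write a = some (x, y) → v.dataX x = v'.dataX x' →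
    v'.term (.inr (a, x')) = v.term (.inl y)) ∧
  ((¬ ∃ x y, I.write a = some (x, y) ∧ v.dataX x = v'.dataX x') →
    ∀ x, v.dataX x = v'.dataX x' → v'.term (.inr (a, x')) = v.term (.inr (a, x)))

/-- Entries of an array at equal indices are equal. -/
def Coherent (v : View σ α β) : Prop :=
  ∀ a x x', v.dataX x = v.dataX x' → v.term (.inr (a, x)) = v.term (.inr (a, x'))

/-- The step of a guarded command on views. The new view has to be coherent; for the old one, this
is not needed. -/
structure Step (c : GuardedCommand σ) (v v' : View σ α β) : Prop where
  guard : v.Holds c.guard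
  bool : ∀ b, v.BoolStep v' b (c.body.bool b)
  dataX : ∀ x, v.XStep v' x (c.body.dataX x)
  dataY : ∀ y, v.YStep v' y (c.body.dataY y)
  arr : ∀ a x', ArrStep c.body v v' a x'
  coherent : v'.Coherent

/-- Everything a program can observe of a view: the booleans and the equality patterns. -/
@[ext]
structure Pattern (σ : Signature) where
  bool : Fin σ.nb → Bool
  eqX : Fin σ.nx → Fin σ.nx → Prop
  eqY : YTerm σ → YTerm σ → Prop

def pattern (v : View σ α β) : Pattern σ where
  bool := v.bool
  eqX x x' := v.dataX x = v.dataX x'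
  eqY t t' := v.term t = v.term t'

theorem pattern_eq_iff {v : View σ α β} {w : View σ α' β'} :
    v.pattern = w.pattern ↔
      v.bool = w.bool ∧ SameKer v.dataX w.dataX ∧ SameKer v.term w.term := by
  simp [pattern, SameKer, funext_iff]

theorem holds_congr {v : View σ α β} {w : View σ α' β'} (h : v.pattern = w.pattern) (e : BExp σ) :
    v.Holds e ↔ w.Holds e := by
  obtain ⟨hb, hX, hT⟩ := pattern_eq_iff.1 h
  induction e with
  | tt => rfl
  | ff => rfl
  | var b => simp [Holds, hb]
  | eqX x x' => exact hX x x'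
  | eqY y y' => exact hT _ _
  | not e ih => exact not_congr ih
  | or e e' ih ih' => exact or_congr ih ih'

theorem coherent_congr {v : View σ α β} {w : View σ α' β'} (h : v.pattern = w.pattern)
    (hv : v.Coherent) : w.Coherent := by
  obtain ⟨hb, hX, hT⟩ := pattern_eq_iff.1 h
  exact fun a x x' hx => (hT _ _).1 (hv a x x' ((hX x x').2 hx))

/-- A step only depends on the joint equality pattern of its two ends. -/
theorem Step.congr {c : GuardedCommand σ} {v v' : View σ α β} {w w' : View σ α' β'}
    (h : Step c v v') (hb : v.bool = w.bool) (hb' : v'.bool = w'.bool)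
    (hX : SameKer (Sum.elim v.dataX v'.dataX) (Sum.elim w.dataX w'.dataX))
    (hT : SameKer (Sum.elim v.term v'.term) (Sum.elim w.term w'.term)) : Step c w w' := by
  have hp : v.pattern = w.pattern := pattern_eq_iff.2
    ⟨hb, fun i j => hX (.inl i) (.inl j), fun i j => hT (.inl i) (.inl j)⟩
  have hp' : v'.pattern = w'.pattern := pattern_eq_iff.2
    ⟨hb', fun i j => hX (.inr i) (.inr j), fun i j => hT (.inr i) (.inr j)⟩
  have X : ∀ i j, v.dataX i = v'.dataX j ↔ w.dataX i = w'.dataX j :=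
    fun i j => hX (.inl i) (.inr j)
  have X' : ∀ i j, v'.dataX i = v.dataX j ↔ w'.dataX i = w.dataX j :=
    fun i j => hX (.inr i) (.inl j)
  have T : ∀ i j, v'.term i = v.term j ↔ w'.term i = w.term j :=
    fun i j => hT (.inr i) (.inl j)
  refine ⟨(holds_congr hp _).1 h.guard, fun b => ?_, fun x => ?_, fun y => ?_, fun a x' => ?_,
    coherent_congr hp' h.coherent⟩
  · have := h.bool b
    revert this
    rcases c.body.bool b with _ | e <;> intro this
    · simpa only [BoolStep, hb, hb'] using this
    · simpa only [BoolStep, hb', holds_congr hp] using this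
  · have := h.dataX x
    revert this
    rcases c.body.dataX x with _ | _ | _ <;> intro this <;>
      first | trivial | simpa only [XStep, X'] using this
  · have := h.dataY y
    revert this
    rcases c.body.dataY y with _ | _ | _ | _ <;> intro this <;>
      first | trivial | simpa only [YStep, T] using this
  · simpa only [ArrStep, X, T] using h.arr a x'

/-- Steps can be copied to any view with the same pattern, provided that there are enough
unused values. -/
theorem exists_step_copy {v v' : View σ α β} {w : View σ α' β'} (h : v.pattern = w.pattern)
    {eX : Fin σ.nx → α'} (hX : Function.Injective eX) (hXw : ∀ j, eX j ∉ Set.range w.dataX)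
    {eT : YTerm σ → β'} (hT : Function.Injective eT) (hTw : ∀ j, eT j ∉ Set.range w.term) :
    ∃ w' : View σ α' β', v'.pattern = w'.pattern ∧ (∀ c, Step c v v' → Step c w w') ∧
      (∀ j, w'.dataX j ∈ Set.range w.dataX ∨ w'.dataX j ∈ Set.range eX) ∧
      (∀ j, w'.term j ∈ Set.range w.term ∨ w'.term j ∈ Set.range eT) := by
  obtain ⟨hb, kX, kT⟩ := pattern_eq_iff.1 h
  obtain ⟨X', hX', hXr⟩ := kX.extend v'.dataX hX hXw
  obtain ⟨T', hT', hTr⟩ := kT.extend v'.term hT hTw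
  refine ⟨⟨v'.bool, X', T'⟩, ?_, fun c hc => hc.congr hb rfl hX' hT', hXr, hTr⟩
  exact pattern_eq_iff.2
    ⟨rfl, fun i j => hX' (.inr i) (.inr j), fun i j => hT' (.inr i) (.inr j)⟩

theorem exists_copy (v : View σ α β) {eX : Fin σ.nx → α'} (hX : Function.Injective eX)
    {eT : YTerm σ → β'} (hT : Function.Injective eT) :
    ∃ w : View σ α' β', v.pattern = w.pattern ∧
      (∀ j, w.dataX j ∈ Set.range eX) ∧ (∀ j, w.term j ∈ Set.range eT) := by
  obtain ⟨X', hX', hXr⟩ := exists_sameKer v.dataX hX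
  obtain ⟨T', hT', hTr⟩ := exists_sameKer v.term hT
  exact ⟨⟨v.bool, X', T'⟩, pattern_eq_iff.2 ⟨rfl, hX', hT'⟩, hXr, hTr⟩

end View

/-! ### The finite system of patterns -/

/-- The transition system of equality patterns. Its steps are those of views over `ℕ`; any infinite
set would give the same steps. -/
def Program.patternSystem (p : Program) : TransitionSystem (Fin p.sig.nb) where
  Q := View.Pattern p.sig
  δ P := {P' | ∃ v v' : View p.sig ℕ ℕ, v.pattern = P ∧ v'.pattern = P' ∧
    ∃ c ∈ p.cmds, View.Step c v v'}
  ext b := {P | P.bool b = true}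

/-- Taking patterns of views is a functional bisimulation for every system whose steps are,
up to patterns, all the steps between the views of its states. -/
theorem isBisimMap_pattern {p : Program} {S : TransitionSystem (Fin p.sig.nb)} {α β : Type*}
    (V : S.Q → View p.sig α β) (hext : ∀ b s, s ∈ S.ext b ↔ (V s).bool b = true)
    (hstep : ∀ s, ∀ s' ∈ S.δ s, ∃ c ∈ p.cmds, View.Step c (V s) (V s'))
    (hlift : ∀ s, ∀ c ∈ p.cmds, ∀ v v' : View p.sig ℕ ℕ, v.pattern = (V s).pattern →
      View.Step c v v' → ∃ s' ∈ S.δ s, v'.pattern = (V s').pattern) :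
    IsBisimMap S p.patternSystem fun s => (V s).pattern where
  ext_iff b s := (hext b s).symm
  push {s s'} h := by
    obtain ⟨c, hc, hs⟩ := hstep s s' h
    obtain ⟨eX, hX, -⟩ := exists_injective_notMem (J := Fin p.sig.nx) (α := ℕ) Set.finite_empty
    obtain ⟨eT, hT, -⟩ := exists_injective_notMem (J := YTerm p.sig) (α := ℕ) Set.finite_empty
    obtain ⟨v, hv, -⟩ := (V s).exists_copy hX hT
    obtain ⟨eX, hX, hXv⟩ := exists_injective_notMem (J := Fin p.sig.nx) (Set.finite_range v.dataX)
    obtain ⟨eT, hT, hTv⟩ := exists_injective_notMem (J := YTerm p.sig) (Set.finite_range v.term)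
    obtain ⟨v', hv', hc', -⟩ := View.exists_step_copy (v' := V s') hv hX hXv hT hTv
    exact ⟨v, v', hv.symm, hv'.symm, c, hc, hc' c hs⟩
  lift {s t} h := by
    obtain ⟨v, v', hv, rfl, c, hc, hs⟩ := h
    obtain ⟨s', hs', h'⟩ := hlift s c hc v v' hv hs
    exact ⟨s', hs', h'.symm⟩

/-! ### The partial-functions semantics maps to patterns -/

namespace PFState

variable {σ : Signature} {A B : Type*}

/-- The value of `a[x]`. -/
noncomputable def entry (s : PFState σ A B) (a : Fin σ.na) (x : Fin σ.nx) : B :=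
  (s.arr a (s.dataX x)).get (Option.isSome_iff_ne_none.2 (s.arr_defined a x))

theorem some_entry (s : PFState σ A B) (a : Fin σ.na) (x : Fin σ.nx) :
    some (s.entry a x) = s.arr a (s.dataX x) := Option.some_get _

noncomputable def view (s : PFState σ A B) : View σ A B where
  bool := s.bool
  dataX := s.dataX
  term := Sum.elim s.dataY fun ax => s.entry ax.1 ax.2

theorem coherent_view (s : PFState σ A B) : s.view.Coherent := by
  intro a x x' h
  change s.entry a x = s.entry a x'
  rw [← Option.some_inj, some_entry, some_entry]
  exact congrArg _ h

theorem holds_view (s : PFState σ A B) (e : BExp σ) : s.view.Holds e ↔ e.Holds s := by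
  induction e with
  | tt => rfl
  | ff => rfl
  | var b => rfl
  | eqX x x' => rfl
  | eqY y y' => rfl
  | not e ih => exact not_congr ih
  | or e e' ih ih' => exact or_congr ih ih'

theorem step_view {c : GuardedCommand σ} {s s' : PFState σ A B} (hg : c.guard.Holds s)
    (h : c.body.Step s s') : View.Step c s.view s'.view := by
  obtain ⟨hb, hX, hY, hA⟩ := h
  refine ⟨(s.holds_view _).2 hg, fun b => ?_, fun x => ?_, fun y => ?_, fun a x' => ⟨?_, ?_⟩,
    s'.coherent_view⟩
  · have := hb b
    revert this
    rcases c.body.bool b with _ | e <;> intro this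
    · exact this
    · exact this.trans (s.holds_view e).symm
  · have := hX x
    revert this
    rcases c.body.dataX x with _ | _ | _ <;> intro this <;> exact this
  · have := hY y
    revert this
    rcases c.body.dataY y with _ | _ | _ | ⟨a, x⟩ <;> intro this
    · exact this
    · exact this
    · trivial
    · rw [ArrayMC.YStep, ← some_entry, Option.some_inj] at this
      exact this
  · intro x y hw hx
    have := (hA a (s'.dataX x')).1 x y hw hx
    rw [← some_entry, Option.some_inj] at this
    exact this
  · intro hw x hx
    change s.dataX x = s'.dataX x' at hx
    have := (hA a (s'.dataX x')).2 hw
      (by rintro ⟨-, -, -, h⟩; exact s.arr_defined a x (hx ▸ h))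
    rw [← some_entry, ← hx, ← some_entry, Option.some_inj] at this
    exact this

open Classical in
/-- A state whose view is a given coherent view, and whose arrays are given by `g` outside the
values of the variables of type `X`. -/
noncomputable def ofView (w : View σ A B) (g : Fin σ.na → A → Option B)
    (hg : ∀ a, {v | g a v ≠ none}.Finite) : PFState σ A B where
  bool := w.bool
  dataX := w.dataX
  dataY y := w.term (.inl y)
  arr a v := if h : ∃ x, w.dataX x = v then some (w.term (.inr (a, h.choose))) else g a v
  arr_finite a := by
    refine ((hg a).union (Set.finite_range w.dataX)).subset fun v hv => ?_
    by_cases h : ∃ x, w.dataX x = v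
    · exact Or.inr h
    · simp only [Set.mem_ofPred_eq, dif_neg h] at hv
      exact Or.inl hv
  arr_defined a x := by simp

section ofView

variable {w : View σ A B} {g : Fin σ.na → A → Option B} {hg : ∀ a, {v | g a v ≠ none}.Finite}

theorem ofView_arr_dataX (hw : w.Coherent) (a : Fin σ.na) (x : Fin σ.nx) :
    (ofView w g hg).arr a (w.dataX x) = some (w.term (.inr (a, x))) := by
  have h : ∃ x', w.dataX x' = w.dataX x := ⟨x, rfl⟩
  simp only [ofView, dif_pos h]
  exact congrArg some (hw a _ _ h.choose_spec)

theorem ofView_arr_of_notMem {a : Fin σ.na} {v : A} (h : v ∉ Set.range w.dataX) :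
    (ofView w g hg).arr a v = g a v := dif_neg h

theorem view_ofView (hw : w.Coherent) : (ofView w g hg).view = w := by
  ext t
  · rfl
  · rfl
  · rcases t with y | ⟨a, x⟩
    · rfl
    · change (ofView w g hg).entry a x = _
      rw [← Option.some_inj, some_entry]
      exact ofView_arr_dataX hw a x

end ofView

/-- The lift of a step of views: it suffices that indices which become current are undefined
in all arrays, so that the choice leaves their entries unconstrained. -/
theorem exists_step {c : GuardedCommand σ} {s : PFState σ A B} {w : View σ A B}
    (h : View.Step c s.view w)
    (hfresh : ∀ x, w.dataX x ∈ Set.range s.dataX ∨ ∀ a, s.arr a (w.dataX x) = none) :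
    ∃ s' : PFState σ A B, s'.view = w ∧ c.guard.Holds s ∧ c.body.Step s s' := by
  classical
  let g : Fin σ.na → A → Option B := fun a v =>
    if h : ∃ x y, c.body.write a = some (x, y) ∧ s.dataX x = v
    then some (s.dataY h.choose_spec.choose) else s.arr a v
  have hg : ∀ a, {v | g a v ≠ none}.Finite := by
    intro a
    refine ((s.arr_finite a).union (Set.finite_range s.dataX)).subset fun v hv => ?_
    by_cases h : ∃ x y, c.body.write a = some (x, y) ∧ s.dataX x = v
    · obtain ⟨x, y, -, hx⟩ := h
      exact Or.inr ⟨x, hx⟩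
    · simp only [Set.mem_ofPred_eq, g, dif_neg h] at hv
      exact Or.inl hv
  have hw := h.coherent
  refine ⟨ofView w g hg, view_ofView hw, (s.holds_view _).1 h.guard, fun b => ?_, fun x => ?_,
    fun y => ?_, fun a v => ⟨?_, ?_⟩⟩
  · have := h.bool b
    revert this
    rcases c.body.bool b with _ | e <;> intro this
    · exact this
    · exact this.trans (s.holds_view e)
  · have := h.dataX x
    revert this
    rcases c.body.dataX x with _ | _ | _ <;> intro this <;> exact this
  · have := h.dataY y
    revert this
    rcases c.body.dataY y with _ | _ | _ | ⟨a, x⟩ <;> intro this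
    · exact this
    · exact this
    · trivial
    · rw [ArrayMC.YStep, ← some_entry]
      exact congrArg some this
  · rintro x y hxy rfl
    by_cases hx : s.dataX x ∈ Set.range w.dataX
    · obtain ⟨x', hx'⟩ := hx
      rw [← hx', ofView_arr_dataX hw, (h.arr a x').1 x y hxy hx'.symm]
      rfl
    · rw [ofView_arr_of_notMem hx]
      have hex : ∃ x₁ y₁, c.body.write a = some (x₁, y₁) ∧ s.dataX x₁ = s.dataX x :=
        ⟨x, y, hxy, rfl⟩
      simp only [g, dif_pos hex]
      have := Option.some_inj.1 (hxy.symm.trans hex.choose_spec.choose_spec.1)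
      exact congrArg (fun z => some (s.dataY z.2)) this.symm
  · intro hnw hnany
    by_cases hv : v ∈ Set.range w.dataX
    · obtain ⟨x', rfl⟩ := hv
      rw [ofView_arr_dataX hw]
      by_cases hold : w.dataX x' ∈ Set.range s.dataX
      · obtain ⟨x, hx⟩ := hold
        rw [(h.arr a x').2 hnw x hx, ← hx, ← some_entry]
        rfl
      · -- Only a nondeterministic choice makes an index current that was not.
        refine absurd ⟨x', ?_, rfl, (hfresh x').resolve_left hold a⟩ hnany
        have := h.dataX x'
        rcases hI : c.body.dataX x' with _ | x | _
        · rw [hI] at this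
          exact absurd ⟨x', this.symm⟩ hold
        · rw [hI] at this
          exact absurd ⟨x, this.symm⟩ hold
        · rfl
    · rw [ofView_arr_of_notMem hv]
      exact dif_neg hnw

end PFState

theorem Program.isBisimMap_pfSem (p : Program) (A B : Type*) [Infinite A] [Infinite B] :
    IsBisimMap (p.pfSem A B) p.patternSystem fun s : PFState p.sig A B => s.view.pattern := by
  refine isBisimMap_pattern (p := p) (S := p.pfSem A B) PFState.view (fun b s => Iff.rfl) ?_ ?_
  · rintro s s' ⟨c, hc, hg, hs⟩
    exact ⟨c, hc, PFState.step_view hg hs⟩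
  · intro (s : PFState p.sig A B) c hc v v' hv hs
    have hfin : (Set.range s.dataX ∪ ⋃ a, {v | s.arr a v ≠ none}).Finite :=
      (Set.finite_range _).union (Set.finite_iUnion s.arr_finite)
    obtain ⟨eX, hX, hXs⟩ := exists_injective_notMem (J := Fin p.sig.nx) hfin
    obtain ⟨eT, hT, hTs⟩ := exists_injective_notMem (J := YTerm p.sig)
      (Set.finite_range s.view.term)
    obtain ⟨w, hw, hstep, hXr, -⟩ := View.exists_step_copy (v' := v') hv hX
      (fun j hj => hXs j (Or.inl hj)) hT hTs
    obtain ⟨s', rfl, hg, hs'⟩ := PFState.exists_step (hstep c hs) (by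
      intro x
      refine (hXr x).imp id ?_
      rintro ⟨j, hj⟩ a
      by_contra hne
      exact hXs j (Or.inr (Set.mem_iUnion.2 ⟨a, by rw [hj]; exact hne⟩)))
    exact ⟨s', ⟨c, hc, hg, hs'⟩, hw⟩

/-- The question about a program over infinite sets, asked of the system of patterns. -/
theorem Program.sat_pfSem_iff (p : Program) (A B : Type*) [Infinite A] [Infinite B]
    (b₀ : Fin p.sig.nb) {φ : Formula (Fin p.sig.nb)} (hφ : φ.Closed) :
    (p.pfSem A B).Sat b₀ φ ↔ ∀ v : View p.sig ℕ ℕ, v.Coherent → v.bool b₀ = true →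
      v.pattern ∈ φ.sem p.patternSystem fun _ => ∅ := by
  have hmem : ∀ s : PFState p.sig A B, (p.pfSem A B).SatAt s φ ↔
      s.view.pattern ∈ φ.sem p.patternSystem fun _ => ∅ := by
    intro s
    refine ((p.pfSem A B).satAt_iff hφ (fun _ => ∅) s).trans ?_
    exact Set.ext_iff.1 ((p.isBisimMap_pfSem A B).mem_sem φ fun _ => ∅) s
  constructor
  · intro h v hv hb
    obtain ⟨eX, hX, -⟩ := exists_injective_notMem (J := Fin p.sig.nx) (α := A) Set.finite_empty
    obtain ⟨eT, hT, -⟩ := exists_injective_notMem (J := YTerm p.sig) (α := B) Set.finite_empty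
    obtain ⟨w, hw, -⟩ := v.exists_copy hX hT
    have hws : (PFState.ofView w (fun _ _ => none) (by simp)).view = w :=
      PFState.view_ofView (View.coherent_congr hw hv)
    rw [hw, ← hws, ← hmem]
    refine h _ ?_
    have := (View.pattern_eq_iff.1 hw).1
    rw [this] at hb
    exact hb
  · intro h (s : PFState p.sig A B) (hs : s.bool b₀ = true)
    obtain ⟨eX, hX, -⟩ := exists_injective_notMem (J := Fin p.sig.nx) (α := ℕ) Set.finite_empty
    obtain ⟨eT, hT, -⟩ := exists_injective_notMem (J := YTerm p.sig) (α := ℕ) Set.finite_empty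
    obtain ⟨v, hv, -⟩ := s.view.exists_copy hX hT
    rw [hmem, hv]
    refine h v (View.coherent_congr hv s.coherent_view) ?_
    rw [← (View.pattern_eq_iff.1 hv).1]
    exact hs

end ArrayMC

/-! ### Primitive recursive predicates -/

section Primrec

variable {α β γ : Type*} [Primcodable α] [Primcodable β] [Primcodable γ]

attribute [fun_prop] Primrec PrimrecPred
attribute [fun_prop] Primrec.id Primrec.const Primrec.comp Primrec.pair Primrec.fst Primrec.snd
attribute [fun_prop] PrimrecPred.not PrimrecPred.and PrimrecPred.or

namespace Primrec

@[fun_prop]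
theorem add_comp {f g : α → ℕ} (hf : Primrec f) (hg : Primrec g) :
    Primrec fun a => f a + g a := nat_add.comp hf hg

@[fun_prop]
theorem sub_comp {f g : α → ℕ} (hf : Primrec f) (hg : Primrec g) :
    Primrec fun a => f a - g a := nat_sub.comp hf hg

@[fun_prop]
theorem mul_comp {f g : α → ℕ} (hf : Primrec f) (hg : Primrec g) :
    Primrec fun a => f a * g a := nat_mul.comp hf hg

@[fun_prop]
theorem div_comp {f g : α → ℕ} (hf : Primrec f) (hg : Primrec g) :
    Primrec fun a => f a / g a := nat_div.comp hf hg

@[fun_prop]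
theorem mod_comp {f g : α → ℕ} (hf : Primrec f) (hg : Primrec g) :
    Primrec fun a => f a % g a := nat_mod.comp hf hg

@[fun_prop]
theorem pow_comp {f g : α → ℕ} (hf : Primrec f) (hg : Primrec g) :
    Primrec fun a => f a ^ g a :=
  (Primrec₂.unpaired'.1 Nat.Primrec.pow).comp hf hg

@[fun_prop]
theorem unpair_comp {f : α → ℕ} (hf : Primrec f) : Primrec fun a => (f a).unpair :=
  unpair.comp hf

@[fun_prop]
theorem getD_comp {f : α → List β} {g : α → ℕ} {d : β} (hf : Primrec f) (hg : Primrec g) :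
    Primrec fun a => (f a).getD (g a) d := (list_getD d).comp hf hg

@[fun_prop]
theorem length_comp {f : α → List β} (hf : Primrec f) : Primrec fun a => (f a).length :=
  list_length.comp hf

end Primrec

namespace PrimrecPred

@[fun_prop]
theorem eq_comp [DecidableEq β] {f g : α → β} (hf : Primrec f) (hg : Primrec g) :
    PrimrecPred fun a => f a = g a := Primrec.eq.comp hf hg

@[fun_prop]
theorem lt_comp {f g : α → ℕ} (hf : Primrec f) (hg : Primrec g) :
    PrimrecPred fun a => f a < g a := Primrec.nat_lt.comp hf hg

theorem imp {p q : α → Prop} (hp : PrimrecPred p) (hq : PrimrecPred q) :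
    PrimrecPred fun a => p a → q a :=
  (hp.not.or hq).of_eq fun a => by tauto

@[fun_prop]
theorem iff {p q : α → Prop} (hp : PrimrecPred p) (hq : PrimrecPred q) :
    PrimrecPred fun a => p a ↔ q a :=
  ((hp.imp hq).and (hq.imp hp)).of_eq fun a => by tauto

theorem exists_lt_comp {f : α → ℕ} {p : α → ℕ → Prop} (hf : Primrec f)
    (hp : PrimrecPred fun z : α × ℕ => p z.1 z.2) : PrimrecPred fun a => ∃ x < f a, p a x := by
  have h : PrimrecRel fun (x : ℕ) (a : α) => p a x :=
    hp.comp (f := fun z : ℕ × α => (z.2, z.1)) (by fun_prop)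
  exact (h.exists_mem_list.comp (Primrec.list_range.comp hf) Primrec.id).of_eq
    fun a => by simp

theorem forall_lt_comp {f : α → ℕ} {p : α → ℕ → Prop} (hf : Primrec f)
    (hp : PrimrecPred fun z : α × ℕ => p z.1 z.2) : PrimrecPred fun a => ∀ x < f a, p a x := by
  have h : PrimrecRel fun (x : ℕ) (a : α) => p a x :=
    hp.comp (f := fun z : ℕ × α => (z.2, z.1)) (by fun_prop)
  exact (h.forall_mem_list.comp (Primrec.list_range.comp hf) Primrec.id).of_eq
    fun a => by simp

end PrimrecPred

end Primrec

namespace ArrayMC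

/-! ### Course-of-values recursion -/

section CourseOfValues

variable {α : Type*}

/-- The values at the arguments below `n` of the predicate defined from `g` by course-of-values
recursion, where `g` is given the list of all previous values; the length of that list is the
current argument. -/
def courseList (g : α → List Bool → Bool) (a : α) : ℕ → List Bool
  | 0 => []
  | n + 1 => courseList g a n ++ [g a (courseList g a n)]

/-- The predicate on `ℕ` defined from `g` by course-of-values recursion. -/
def course (g : α → List Bool → Bool) (a : α) (n : ℕ) : Bool := g a (courseList g a n)

theorem length_courseList (g : α → List Bool → Bool) (a : α) (n : ℕ) :
    (courseList g a n).length = n := by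
  induction n with
  | zero => rfl
  | succ n ih => simp [courseList, ih]

theorem getD_courseList (g : α → List Bool → Bool) (a : α) {i n : ℕ} (h : i < n) :
    (courseList g a n).getD i false = course g a i := by
  induction n with
  | zero => omega
  | succ n ih =>
    rcases Nat.lt_succ_iff_lt_or_eq.1 h with h | rfl
    · rw [← ih h, courseList, List.getD_append _ _ _ _ (by rwa [length_courseList])]
    · rw [courseList, List.getD_append_right _ _ _ _ (by rw [length_courseList])]
      simp [length_courseList, course]

theorem primrec_course [Primcodable α] {β : Type*} [Primcodable β] {g : α → List Bool → Bool}
    (hg : Primrec fun z : α × List Bool => g z.1 z.2) {f : β → α} {h : β → ℕ} (hf : Primrec f)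
    (hh : Primrec h) : Primrec fun b => course g (f b) (h b) := by
  have hl : Primrec₂ (courseList g) := by
    refine (Primrec.nat_rec (f := fun _ : α => ([] : List Bool))
      (g := fun a z => z.2 ++ [g a z.2]) (Primrec.const _) ?_).of_eq fun a n => ?_
    · exact Primrec.list_concat.comp (Primrec.snd.comp Primrec.snd)
        (hg.comp (Primrec.fst.pair (Primrec.snd.comp Primrec.snd)))
    · induction n with
      | zero => rfl
      | succ n ih => simp only [courseList, ← ih]
  exact hg.comp (hf.pair (hl.comp hf hh))

end CourseOfValues

/-! ### Coded lists and digits -/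

/-- The list of natural numbers coded by `c`. -/
def entries (c : ℕ) : List ℕ := (Encodable.decode c : Option (List ℕ)).getD []

/-- The entry at `i` of the list coded by `c`. -/
def ent (c i : ℕ) : ℕ := (entries c).getD i 0

@[simp]
theorem entries_encode (l : List ℕ) : entries (Encodable.encode l) = l := by simp [entries]

@[simp]
theorem ent_encode (l : List ℕ) (i : ℕ) : ent (Encodable.encode l) i = l.getD i 0 := by simp [ent]

/-- The `i`-th digit of `q` in base `L`. -/
def digit (L q i : ℕ) : ℕ := q / L ^ i % L

theorem exists_digit_eq {L n : ℕ} (f : ℕ → ℕ) (hf : ∀ i < n, f i < L) :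
    ∃ q < L ^ n, ∀ i < n, digit L q i = f i := by
  let F : Fin n → Fin L := fun i => ⟨f i, hf i i.2⟩
  refine ⟨finFunctionFinEquiv F, (finFunctionFinEquiv F).2, fun i hi => ?_⟩
  have := congrArg Fin.val (congrFun (finFunctionFinEquiv.symm_apply_apply F) ⟨i, hi⟩)
  exact this

theorem exists_bits_iff {n : ℕ} (P : ℕ → Prop) :
    ∃ E < 2 ^ n, ∀ i < n, digit 2 E i = 1 ↔ P i := by
  classical
  obtain ⟨E, hE, h⟩ := exists_digit_eq (L := 2) (n := n) (fun i => if P i then 1 else 0)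
    (by intro i _; split <;> omega)
  exact ⟨E, hE, fun i hi => by rw [h i hi]; simp⟩

theorem digit_eq_zero_of_lt {L n q i : ℕ} (hL : 0 < L) (hq : q < L ^ n) (hi : n ≤ i) :
    digit L q i = 0 := by
  rw [digit, Nat.div_eq_of_lt (hq.trans_le (Nat.pow_le_pow_right hL hi)), Nat.zero_mod]

section Primrec

variable {α : Type*} [Primcodable α]

@[fun_prop]
theorem primrec_entries {f : α → ℕ} (hf : Primrec f) : Primrec fun a => entries (f a) :=
  Primrec.option_getD.comp (Primrec.decode.comp hf) (Primrec.const _)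

@[fun_prop]
theorem primrec_ent {f g : α → ℕ} (hf : Primrec f) (hg : Primrec g) :
    Primrec fun a => ent (f a) (g a) := by unfold ent; fun_prop

@[fun_prop]
theorem primrec_digit {f g h : α → ℕ} (hf : Primrec f) (hg : Primrec g) (hh : Primrec h) :
    Primrec fun a => digit (f a) (g a) (h a) := by unfold digit; fun_prop

end Primrec

/-! ### The decision procedure -/

/-! The following functions and predicates take the code `n` of an input and read off its parts. -/

namespace Input

def nb (n : ℕ) : ℕ := ent (ent n 0) 0
def nx (n : ℕ) : ℕ := ent (ent n 0) 1
def ny (n : ℕ) : ℕ := ent (ent n 0) 2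
def na (n : ℕ) : ℕ := ent (ent n 0) 3
def cmds (n : ℕ) : ℕ := ent (ent n 0) 4
def b₀ (n : ℕ) : ℕ := ent n 1
def form (n : ℕ) : ℕ := ent n 2

/-- The number of components of a view. -/
def dim (n : ℕ) : ℕ := nb n + nx n + ny n + nx n * na n

/-- Views are coded by digits in this base. It is at least two, for the booleans, and at least
twice the number of values of each type in a view, so that there is room for the new values of a
step. -/
def base (n : ℕ) : ℕ := 2 * dim n + 2

/-- Views are coded by the numbers below this bound. -/
def size (n : ℕ) : ℕ := base n ^ dim n

/-! The components of the view coded by `q`; a boolean is true if its digit is `1`. -/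

def bool (n q b : ℕ) : ℕ := digit (base n) q b
def dataX (n q x : ℕ) : ℕ := digit (base n) q (nb n + x)
def dataY (n q y : ℕ) : ℕ := digit (base n) q (nb n + nx n + y)
def entry (n q a x : ℕ) : ℕ := digit (base n) q (nb n + nx n + ny n + (x + nx n * a))

/-- The recursive clauses for the truth in the view `q` of the boolean expression whose code is the
length of `l`, given the list `l` of the truth values of all expressions with smaller codes. -/
def HoldsClause (n q : ℕ) (l : List Bool) : Prop :=
  l.length.unpair.1 = 0 ∨
  l.length.unpair.1 = 2 ∧ bool n q l.length.unpair.2 = 1 ∨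
  l.length.unpair.1 = 3 ∧
    dataX n q l.length.unpair.2.unpair.1 = dataX n q l.length.unpair.2.unpair.2 ∨
  l.length.unpair.1 = 4 ∧
    dataY n q l.length.unpair.2.unpair.1 = dataY n q l.length.unpair.2.unpair.2 ∨
  l.length.unpair.1 = 5 ∧ ¬ l.getD l.length.unpair.2 false = true ∨
  l.length.unpair.1 = 6 ∧ (l.getD l.length.unpair.2.unpair.1 false = true ∨
    l.getD l.length.unpair.2.unpair.2 false = true)

open Classical in
/-- Truth of the boolean expression with code `e` in the view `q`. -/
noncomputable def holds (n q e : ℕ) : Bool :=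
  course (fun z l => decide (HoldsClause z.1 z.2 l)) (n, q) e

/-- The field `k` of the command `c` at the variable `i`; it is zero if there is no assignment and
otherwise one more than the code of the assignment. -/
def field (c k i : ℕ) : ℕ := ent (ent c.unpair.2 k) i

/-! The effect on a variable of its assignment, given by the entry `o` of the command as in `field`,
in the step from the view `q` to the view `q'`. -/

def BoolStep (n q q' b o : ℕ) : Prop :=
  o = 0 ∧ (bool n q' b = 1 ↔ bool n q b = 1) ∨
  ¬ o = 0 ∧ (bool n q' b = 1 ↔ holds n q (o - 1) = true)

def XStep (n q q' x o : ℕ) : Prop :=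
  o = 0 ∧ dataX n q' x = dataX n q x ∨
  ¬ o = 0 ∧ (o - 1).unpair.1 = 0 ∧ dataX n q' x = dataX n q (o - 1).unpair.2 ∨
  ¬ o = 0 ∧ (o - 1).unpair.1 = 1

def YStep (n q q' y o : ℕ) : Prop :=
  o = 0 ∧ dataY n q' y = dataY n q y ∨
  ¬ o = 0 ∧ (o - 1).unpair.1 = 0 ∧ dataY n q' y = dataY n q (o - 1).unpair.2 ∨
  ¬ o = 0 ∧ (o - 1).unpair.1 = 1 ∨
  ¬ o = 0 ∧ (o - 1).unpair.1 = 2 ∧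
    dataY n q' y = entry n q (o - 1).unpair.2.unpair.1 (o - 1).unpair.2.unpair.2

def ArrStep (n q q' a x' o : ℕ) : Prop :=
  (¬ o = 0 ∧ dataX n q (o - 1).unpair.1 = dataX n q' x' ∧
    entry n q' a x' = dataY n q (o - 1).unpair.2) ∨
  (¬ (¬ o = 0 ∧ dataX n q (o - 1).unpair.1 = dataX n q' x') ∧
    ∀ x < nx n, ¬ dataX n q x = dataX n q' x' ∨ entry n q' a x' = entry n q a x)

/-- The view coded by `q` is coherent. -/
def Coherent (n q : ℕ) : Prop :=
  ∀ a < na n, ∀ x < nx n, ∀ x' < nx n,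
    ¬ dataX n q x = dataX n q x' ∨ entry n q a x = entry n q a x'

/-- The step of the guarded command with code `c` from the view `q` to the view `q'`. -/
def CommandStep (n c q q' : ℕ) : Prop :=
  holds n q c.unpair.1 = true ∧
  (∀ b < nb n, BoolStep n q q' b (field c 0 b)) ∧
  (∀ x < nx n, XStep n q q' x (field c 1 x)) ∧
  (∀ y < ny n, YStep n q q' y (field c 2 y)) ∧
  (∀ a < na n, ∀ x' < nx n, ArrStep n q q' a x' (field c 3 a)) ∧
  Coherent n q'

/-- Some guarded command of the program has a step from the view `q` to the view `q'`. -/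
def Step (n q q' : ℕ) : Prop :=
  ∃ j < (entries (cmds n)).length, CommandStep n (ent (cmds n) j) q q'

/-- All fixpoint variables of the formula are below this bound. -/
def numVars (n : ℕ) : ℕ := form n + 1

/-- Assignments of sets of views to the fixpoint variables are coded, as bit vectors, by the numbers
below this bound. -/
def envSize (n : ℕ) : ℕ := 2 ^ (numVars n * size n)

/-- The view `q` is in the set assigned by `E` to the fixpoint variable `h`. -/
def Bit (n E h q : ℕ) : Prop := digit 2 E (h * size n + q) = 1

/-- `E'` agrees with the assignment `E` off `h`, and assigns to `h` the set `R E'`. If `R E'` is the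
meaning of a formula under `E'`, this says that the new value of `h` is a fixpoint of the
formula. -/
def IsFixUpdate (n : ℕ) (R : ℕ → ℕ → Prop) (E h E' : ℕ) : Prop :=
  (∀ k < numVars n, ∀ q < size n, k = h ∨ (Bit n E' k q ↔ Bit n E k q)) ∧
  ∀ q < size n, Bit n E' h q ↔ R E' q

/-- The recursive clauses for the truth at the view `q`, relative to the assignment `E`, of the
formula with code `c`, given the truth `R c' E' q'` of formulas with smaller codes. -/
def SemClause (n : ℕ) (R : ℕ → ℕ → ℕ → Prop) (c E q : ℕ) : Prop :=
  c.unpair.1 = 0 ∧ bool n q c.unpair.2 = 1 ∨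
  c.unpair.1 = 1 ∧ ¬ bool n q c.unpair.2 = 1 ∨
  c.unpair.1 = 2 ∧ Bit n E c.unpair.2 q ∨
  c.unpair.1 = 3 ∧ (R c.unpair.2.unpair.1 E q ∨ R c.unpair.2.unpair.2 E q) ∨
  c.unpair.1 = 4 ∧ (R c.unpair.2.unpair.1 E q ∧ R c.unpair.2.unpair.2 E q) ∨
  c.unpair.1 = 5 ∧ (∃ q' < size n, Step n q q' ∧ R c.unpair.2 E q') ∨
  c.unpair.1 = 6 ∧ (∀ q' < size n, ¬ Step n q q' ∨ R c.unpair.2 E q') ∨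
  c.unpair.1 = 7 ∧ (∀ E' < envSize n,
    ¬ IsFixUpdate n (R c.unpair.2.unpair.2) E c.unpair.2.unpair.1 E' ∨
      Bit n E' c.unpair.2.unpair.1 q) ∨
  c.unpair.1 = 8 ∧ (∃ E' < envSize n,
    IsFixUpdate n (R c.unpair.2.unpair.2) E c.unpair.2.unpair.1 E' ∧
      Bit n E' c.unpair.2.unpair.1 q)

/-- Triples of a formula, an assignment and a view are numbered so that smaller formulas come
first. -/
def index (n c E q : ℕ) : ℕ := (c * envSize n + E) * size n + q

/-- Look up a truth value in a list of previous values. The guards restrict the values used for the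
formula with code `c` to those already in the list. -/
def lookup (n c : ℕ) (l : List Bool) (c' E' q' : ℕ) : Prop :=
  c' < c ∧ E' < envSize n ∧ q' < size n ∧ l.getD (index n c' E' q') false = true

open Classical in
/-- Truth at the view `q`, relative to the assignment `E`, of the formula with code `c`. -/
noncomputable def sem (n c E q : ℕ) : Bool :=
  course (fun n l => decide
    (SemClause n (lookup n (l.length / size n / envSize n) l)
      (l.length / size n / envSize n) (l.length / size n % envSize n) (l.length % size n)))
    n (index n c E q)

/-- The formula of the input holds at all coherent views at which `b₀` is true. -/
def Accepts (n : ℕ) : Prop :=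
  ∀ q < size n, ¬ (Coherent n q ∧ bool n q (b₀ n) = 1) ∨ sem n (form n) 0 q = true

/-! ### The decision procedure is primitive recursive -/

section Primrec

variable {α : Type*} [Primcodable α] {f g h k u v w : α → ℕ}

@[fun_prop]
theorem primrec_nb (hf : Primrec f) : Primrec fun a => nb (f a) := by unfold nb; fun_prop

@[fun_prop]
theorem primrec_nx (hf : Primrec f) : Primrec fun a => nx (f a) := by unfold nx; fun_prop

@[fun_prop]
theorem primrec_ny (hf : Primrec f) : Primrec fun a => ny (f a) := by unfold ny; fun_prop

@[fun_prop]
theorem primrec_na (hf : Primrec f) : Primrec fun a => na (f a) := by unfold na; fun_prop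

@[fun_prop]
theorem primrec_cmds (hf : Primrec f) : Primrec fun a => cmds (f a) := by unfold cmds; fun_prop

@[fun_prop]
theorem primrec_b₀ (hf : Primrec f) : Primrec fun a => b₀ (f a) := by unfold b₀; fun_prop

@[fun_prop]
theorem primrec_form (hf : Primrec f) : Primrec fun a => form (f a) := by unfold form; fun_prop

@[fun_prop]
theorem primrec_dim (hf : Primrec f) : Primrec fun a => dim (f a) := by unfold dim; fun_prop

@[fun_prop]
theorem primrec_base (hf : Primrec f) : Primrec fun a => base (f a) := by unfold base; fun_prop

@[fun_prop]
theorem primrec_size (hf : Primrec f) : Primrec fun a => size (f a) := by unfold size; fun_prop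

@[fun_prop]
theorem primrec_bool (hf : Primrec f) (hg : Primrec g) (hh : Primrec h) :
    Primrec fun a => bool (f a) (g a) (h a) := by unfold bool; fun_prop

@[fun_prop]
theorem primrec_dataX (hf : Primrec f) (hg : Primrec g) (hh : Primrec h) :
    Primrec fun a => dataX (f a) (g a) (h a) := by unfold dataX; fun_prop

@[fun_prop]
theorem primrec_dataY (hf : Primrec f) (hg : Primrec g) (hh : Primrec h) :
    Primrec fun a => dataY (f a) (g a) (h a) := by unfold dataY; fun_prop

@[fun_prop]
theorem primrec_entry (hf : Primrec f) (hg : Primrec g) (hh : Primrec h) (hk : Primrec k) :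
    Primrec fun a => entry (f a) (g a) (h a) (k a) := by unfold entry; fun_prop

@[fun_prop]
theorem primrec_field (hf : Primrec f) (hg : Primrec g) (hh : Primrec h) :
    Primrec fun a => field (f a) (g a) (h a) := by unfold field; fun_prop

@[fun_prop]
theorem primrec_numVars (hf : Primrec f) : Primrec fun a => numVars (f a) := by
  unfold numVars; fun_prop

@[fun_prop]
theorem primrec_envSize (hf : Primrec f) : Primrec fun a => envSize (f a) := by
  unfold envSize; fun_prop

@[fun_prop]
theorem primrec_index (hf : Primrec f) (hg : Primrec g) (hh : Primrec h) (hk : Primrec k) :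
    Primrec fun a => index (f a) (g a) (h a) (k a) := by unfold index; fun_prop

@[fun_prop]
theorem primrec_holds (hf : Primrec f) (hg : Primrec g) (hh : Primrec h) :
    Primrec fun a => holds (f a) (g a) (h a) := by
  classical
  refine primrec_course (PrimrecPred.decide ?_) (by fun_prop) hh
  unfold HoldsClause
  fun_prop

@[fun_prop]
theorem primrecPred_boolStep (hf : Primrec f) (hg : Primrec g) (hh : Primrec h) (hk : Primrec k)
    (hu : Primrec u) : PrimrecPred fun a => BoolStep (f a) (g a) (h a) (k a) (u a) := by
  unfold BoolStep; fun_prop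

@[fun_prop]
theorem primrecPred_xStep (hf : Primrec f) (hg : Primrec g) (hh : Primrec h) (hk : Primrec k)
    (hu : Primrec u) : PrimrecPred fun a => XStep (f a) (g a) (h a) (k a) (u a) := by
  unfold XStep; fun_prop

@[fun_prop]
theorem primrecPred_yStep (hf : Primrec f) (hg : Primrec g) (hh : Primrec h) (hk : Primrec k)
    (hu : Primrec u) : PrimrecPred fun a => YStep (f a) (g a) (h a) (k a) (u a) := by
  unfold YStep; fun_prop

@[fun_prop]
theorem primrecPred_arrStep (hf : Primrec f) (hg : Primrec g) (hh : Primrec h) (hk : Primrec k)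
    (hu : Primrec u) (hv : Primrec v) :
    PrimrecPred fun a => ArrStep (f a) (g a) (h a) (k a) (u a) (v a) := by
  unfold ArrStep
  refine .or (by fun_prop) (.and (by fun_prop) (.forall_lt_comp (by fun_prop) (by fun_prop)))

@[fun_prop]
theorem primrecPred_coherent (hf : Primrec f) (hg : Primrec g) :
    PrimrecPred fun a => Coherent (f a) (g a) := by
  unfold Coherent
  refine .forall_lt_comp (by fun_prop) (.forall_lt_comp (by fun_prop)
    (.forall_lt_comp (by fun_prop) (by fun_prop)))

@[fun_prop]
theorem primrecPred_commandStep (hf : Primrec f) (hg : Primrec g) (hh : Primrec h)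
    (hk : Primrec k) : PrimrecPred fun a => CommandStep (f a) (g a) (h a) (k a) := by
  unfold CommandStep
  refine .and (by fun_prop) (.and (.forall_lt_comp ?_ ?_) (.and (.forall_lt_comp ?_ ?_)
    (.and (.forall_lt_comp ?_ ?_) (.and (.forall_lt_comp ?_ (.forall_lt_comp ?_ ?_)) ?_))))
  all_goals fun_prop

@[fun_prop]
theorem primrecPred_step (hf : Primrec f) (hg : Primrec g) (hh : Primrec h) :
    PrimrecPred fun a => Step (f a) (g a) (h a) := by
  unfold Step
  refine .exists_lt_comp ?_ ?_ <;> fun_prop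

@[fun_prop]
theorem primrecPred_bit (hf : Primrec f) (hg : Primrec g) (hh : Primrec h) (hk : Primrec k) :
    PrimrecPred fun a => Bit (f a) (g a) (h a) (k a) := by unfold Bit; fun_prop

@[fun_prop]
theorem primrecPred_lookup {l : α → List Bool} (hf : Primrec f) (hg : Primrec g) (hl : Primrec l)
    (hh : Primrec h) (hk : Primrec k) (hu : Primrec u) :
    PrimrecPred fun a => lookup (f a) (g a) (l a) (h a) (k a) (u a) := by unfold lookup; fun_prop

@[fun_prop]
theorem primrecPred_isFixUpdate {l : α → List Bool} (hf : Primrec f) (hg : Primrec g)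
    (hl : Primrec l) (hh : Primrec h) (hk : Primrec k) (hu : Primrec u) (hv : Primrec v) :
    PrimrecPred fun a =>
      IsFixUpdate (f a) (lookup (f a) (g a) (l a) (h a)) (k a) (u a) (v a) := by
  unfold IsFixUpdate
  refine .and (.forall_lt_comp ?_ (.forall_lt_comp ?_ ?_)) (.forall_lt_comp ?_ ?_) <;> fun_prop

theorem primrecPred_semClause {l : α → List Bool} (hf : Primrec f) (hg : Primrec g)
    (hl : Primrec l) (hh : Primrec h) (hk : Primrec k) :
    PrimrecPred fun a =>
      SemClause (f a) (lookup (f a) (g a) (l a)) (g a) (h a) (k a) := by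
  unfold SemClause
  refine .or ?_ (.or ?_ (.or ?_ (.or ?_ (.or ?_ (.or (.and ?_ (.exists_lt_comp ?_ ?_))
    (.or (.and ?_ (.forall_lt_comp ?_ ?_)) (.or (.and ?_ (.forall_lt_comp ?_ ?_))
      (.and ?_ (.exists_lt_comp ?_ ?_)))))))))
  all_goals fun_prop

@[fun_prop]
theorem primrec_sem (hf : Primrec f) (hg : Primrec g) (hh : Primrec h) (hk : Primrec k) :
    Primrec fun a => sem (f a) (g a) (h a) (k a) := by
  classical
  refine primrec_course (PrimrecPred.decide (primrecPred_semClause ?_ ?_ ?_ ?_ ?_)) hf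
    (by fun_prop)
  all_goals fun_prop

theorem primrecPred_accepts : PrimrecPred Accepts := by
  unfold Accepts
  refine .forall_lt_comp ?_ ?_ <;> fun_prop

end Primrec

end Input

end ArrayMC

/-! ### Correctness of the decision procedure -/

namespace ArrayMC

theorem getD_ofFn {n : ℕ} (f : Fin n → ℕ) (k : Fin n) : (List.ofFn f).getD k 0 = f k := by
  simp [List.getD_eq_getElem?_getD]

@[simp]
theorem ent_codeFamily {n : ℕ} {α : Type*} (c : α → ℕ) (f : Fin n → Option α) (k : Fin n) :
    ent (codeFamily c f) k = (f k).elim 0 fun t => c t + 1 := by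
  rw [codeFamily, ent_encode, getD_ofFn]

namespace Input

variable (i : Problem)

@[simp] theorem nb_code : nb i.code = i.prog.sig.nb := by
  simp [nb, Problem.code, Program.code, -Encodable.encode_list_cons]
@[simp] theorem nx_code : nx i.code = i.prog.sig.nx := by
  simp [nx, Problem.code, Program.code, -Encodable.encode_list_cons]
@[simp] theorem ny_code : ny i.code = i.prog.sig.ny := by
  simp [ny, Problem.code, Program.code, -Encodable.encode_list_cons]
@[simp] theorem na_code : na i.code = i.prog.sig.na := by
  simp [na, Problem.code, Program.code, -Encodable.encode_list_cons]
@[simp] theorem entries_cmds_code :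
    entries (cmds i.code) = i.prog.cmds.map GuardedCommand.code := by
  simp [cmds, Problem.code, Program.code, -Encodable.encode_list_cons]
@[simp] theorem b₀_code : b₀ i.code = i.b₀ := by
  simp [b₀, Problem.code, -Encodable.encode_list_cons]
@[simp] theorem form_code : form i.code = i.φ.code := by
  simp [form, Problem.code, -Encodable.encode_list_cons]

/-! ### The view coded by a number -/

variable {i}

/-- The view coded by the number `q`. -/
def toView (i : Problem) (q : ℕ) : View i.prog.sig ℕ ℕ where
  bool b := decide (bool i.code q b = 1)
  dataX x := dataX i.code q x
  term := Sum.elim (fun y => dataY i.code q y) fun ax => entry i.code q ax.1 ax.2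

/-- Every view whose values are digits is coded by a number. -/
theorem exists_toView_eq (v : View i.prog.sig ℕ ℕ) (hX : ∀ x, v.dataX x < base i.code)
    (hT : ∀ t, v.term t < base i.code) : ∃ q < size i.code, toView i q = v := by
  let pos : Fin i.prog.sig.nb ⊕ Fin i.prog.sig.nx ⊕ YTerm i.prog.sig → ℕ :=
    Sum.elim (fun b => b) (Sum.elim (fun x => i.prog.sig.nb + x)
      (Sum.elim (fun y => i.prog.sig.nb + i.prog.sig.nx + y)
        fun ax => i.prog.sig.nb + i.prog.sig.nx + i.prog.sig.ny + finProdFinEquiv ax))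
  let val : Fin i.prog.sig.nb ⊕ Fin i.prog.sig.nx ⊕ YTerm i.prog.sig → ℕ :=
    Sum.elim (fun b => if v.bool b = true then 1 else 0) (Sum.elim v.dataX v.term)
  have hpos : Function.Injective pos := by
    rintro (b | x | y | ax) (b' | x' | y' | ax') h <;>
      simp only [pos, Sum.elim_inl, Sum.elim_inr] at h
    all_goals first
      | (exfalso; omega)
      | (congr; omega)
      | skip
    have : finProdFinEquiv ax = finProdFinEquiv ax' := by omega
    rw [finProdFinEquiv.injective this]
  have hval : ∀ t, val t < base i.code := by
    rintro (b | x | t)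
    · simp only [val, Sum.elim_inl, base]
      split <;> omega
    · exact hX x
    · exact hT t
  obtain ⟨q, hq, h⟩ := exists_digit_eq (L := base i.code) (n := dim i.code)
    (Function.extend pos val 0) (by
      intro j _
      by_cases hj : ∃ t, pos t = j
      · obtain ⟨t, rfl⟩ := hj
        rw [hpos.extend_apply]
        exact hval t
      · rw [Function.extend_apply' _ _ _ hj]
        simp [base])
  have hq' : ∀ t, pos t < dim i.code → digit (base i.code) q (pos t) = val t :=
    fun t ht => by rw [h _ ht, hpos.extend_apply]
  refine ⟨q, hq, ?_⟩
  ext t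
  · have := hq' (.inl t) (by simp [pos, dim]; omega)
    simp only [pos, val, Sum.elim_inl] at this
    simp only [toView, bool, this]
    cases v.bool t <;> simp
  · have := hq' (.inr (.inl t)) (by simp [pos, dim]; omega)
    simpa [toView, dataX, pos, val] using this
  · rcases t with y | ⟨a, x⟩
    · have := hq' (.inr (.inr (.inl y))) (by simp [pos, dim]; omega)
      simpa [toView, dataY, pos, val] using this
    · have hlt := (finProdFinEquiv (a, x)).2
      have := hq' (.inr (.inr (.inr (a, x)))) (by
        simp only [pos, dim, Sum.elim_inr, nb_code, nx_code, ny_code, na_code]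
        rw [mul_comm i.prog.sig.nx]
        omega)
      simpa [toView, entry, pos, val] using this

theorem exists_holdsClause (n q e : ℕ) : ∃ l : List Bool, l.length = e ∧
    (∀ e' < e, l.getD e' false = holds n q e') ∧ (holds n q e = true ↔ HoldsClause n q l) := by
  classical
  exact ⟨_, length_courseList _ _ _, fun e' h => getD_courseList _ _ h, decide_eq_true_iff⟩

theorem holds_code (q : ℕ) (e : BExp i.prog.sig) :
    holds i.code q e.code = true ↔ (toView i q).Holds e := by
  have lt_pair : ∀ {k r : ℕ}, 0 < k → r < Nat.pair k r :=
    fun hk => by have := Nat.add_le_pair; grind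
  induction e with
  | tt =>
    obtain ⟨l, hl, -, h⟩ := exists_holdsClause i.code q (BExp.tt (σ := i.prog.sig)).code
    rw [h, HoldsClause, hl]
    simp [BExp.code, View.Holds]
  | ff =>
    obtain ⟨l, hl, -, h⟩ := exists_holdsClause i.code q (BExp.ff (σ := i.prog.sig)).code
    rw [h, HoldsClause, hl]
    simp [BExp.code, View.Holds]
  | var b =>
    obtain ⟨l, hl, -, h⟩ := exists_holdsClause i.code q (BExp.var b).code
    rw [h, HoldsClause, hl]
    simp [BExp.code, View.Holds, toView]
  | eqX x x' =>
    obtain ⟨l, hl, -, h⟩ := exists_holdsClause i.code q (BExp.eqX x x').code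
    rw [h, HoldsClause, hl]
    simp [BExp.code, View.Holds, toView]
  | eqY y y' =>
    obtain ⟨l, hl, -, h⟩ := exists_holdsClause i.code q (BExp.eqY y y').code
    rw [h, HoldsClause, hl]
    simp [BExp.code, View.Holds, toView]
  | not e ih =>
    obtain ⟨l, hl, hp, h⟩ := exists_holdsClause i.code q (BExp.not e).code
    have h1 := hp e.code (lt_pair (by norm_num))
    rw [h, HoldsClause, hl]
    simp [BExp.code, View.Holds, h1, ← ih, -List.getD_eq_getElem?_getD]
  | or e e' ih ih' =>
    obtain ⟨l, hl, hp, h⟩ := exists_holdsClause i.code q (BExp.or e e').code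
    have h1 := hp e.code ((Nat.left_le_pair _ _).trans_lt (lt_pair (by norm_num)))
    have h2 := hp e'.code ((Nat.right_le_pair _ _).trans_lt (lt_pair (by norm_num)))
    rw [h, HoldsClause, hl]
    simp [BExp.code, View.Holds, h1, h2, ← ih, ← ih', -List.getD_eq_getElem?_getD]

theorem coherent_iff (q : ℕ) : Coherent i.code q ↔ (toView i q).Coherent := by
  simp only [Coherent, View.Coherent, na_code, nx_code, ← imp_iff_not_or]
  exact ⟨fun h a x x' => h a a.2 x x.2 x' x'.2,
    fun h a ha x hx x' hx' => h ⟨a, ha⟩ ⟨x, hx⟩ ⟨x', hx'⟩⟩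

section CommandStep

variable {q q' : ℕ} (c : GuardedCommand i.prog.sig)

theorem boolStep_code (b : Fin i.prog.sig.nb) :
    BoolStep i.code q q' b (field c.code 0 b) ↔
      (toView i q).BoolStep (toView i q') b (c.body.bool b) := by
  simp only [field, GuardedCommand.code, Command.code, Nat.unpair_pair, ent_encode,
    List.getD_cons_zero, ent_codeFamily]
  rcases c.body.bool b with _ | e
  · simp [BoolStep, View.BoolStep, toView]
  · have : (toView i q').bool b = true ↔ bool i.code q' b = 1 := decide_eq_true_iff
    simp [BoolStep, View.BoolStep, ← holds_code, this]

theorem xStep_code (x : Fin i.prog.sig.nx) :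
    XStep i.code q q' x (field c.code 1 x) ↔
      (toView i q).XStep (toView i q') x (c.body.dataX x) := by
  simp only [field, GuardedCommand.code, Command.code, Nat.unpair_pair, ent_encode,
    List.getD_cons_zero, List.getD_cons_succ, ent_codeFamily]
  rcases c.body.dataX x with _ | _ | _ <;> simp [XStep, View.XStep, toView, XAssign.code]

theorem yStep_code (y : Fin i.prog.sig.ny) :
    YStep i.code q q' y (field c.code 2 y) ↔
      (toView i q).YStep (toView i q') y (c.body.dataY y) := by
  simp only [field, GuardedCommand.code, Command.code, Nat.unpair_pair, ent_encode,
    List.getD_cons_zero, List.getD_cons_succ, ent_codeFamily]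
  rcases c.body.dataY y with _ | _ | _ | _ <;> simp [YStep, View.YStep, toView, YAssign.code]

theorem arrStep_code (a : Fin i.prog.sig.na) (x' : Fin i.prog.sig.nx) :
    ArrStep i.code q q' a x' (field c.code 3 a) ↔
      View.ArrStep c.body (toView i q) (toView i q') a x' := by
  have forall_lt : ∀ P : ℕ → Prop, (∀ x < nx i.code, P x) ↔ ∀ x : Fin i.prog.sig.nx, P x := by
    intro P
    rw [nx_code]
    exact ⟨fun h x => h x x.2, fun h x hx => h ⟨x, hx⟩⟩
  simp only [field, GuardedCommand.code, Command.code, Nat.unpair_pair, ent_encode,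
    List.getD_cons_zero, List.getD_cons_succ, ent_codeFamily, ArrStep, View.ArrStep, forall_lt]
  rcases c.body.write a with _ | ⟨x, y⟩
  · simp [toView, imp_iff_not_or]
  · simp [toView, imp_iff_not_or]
    grind

theorem commandStep_code :
    CommandStep i.code c.code q q' ↔ View.Step c (toView i q) (toView i q') := by
  have guard : holds i.code q c.code.unpair.1 = true ↔ (toView i q).Holds c.guard := by
    rw [GuardedCommand.code, Nat.unpair_pair]
    exact holds_code q _
  simp only [CommandStep, nb_code, nx_code, ny_code, na_code, guard, coherent_iff]
  constructor
  · rintro ⟨h, hb, hX, hY, hA, hc⟩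
    exact ⟨h, fun b => (boolStep_code c b).1 (hb b b.2), fun x => (xStep_code c x).1 (hX x x.2),
      fun y => (yStep_code c y).1 (hY y y.2),
      fun a x' => (arrStep_code c a x').1 (hA a a.2 x' x'.2), hc⟩
  · rintro ⟨h, hb, hX, hY, hA, hc⟩
    exact ⟨h, fun b hb' => (boolStep_code c ⟨b, hb'⟩).2 (hb _),
      fun x hx => (xStep_code c ⟨x, hx⟩).2 (hX _), fun y hy => (yStep_code c ⟨y, hy⟩).2 (hY _),
      fun a ha x' hx => (arrStep_code c ⟨a, ha⟩ ⟨x', hx⟩).2 (hA _ _), hc⟩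

end CommandStep

/-- The finite transition system whose states are the codes of views. -/
def system (i : Problem) : TransitionSystem (Fin i.prog.sig.nb) where
  Q := Fin (size i.code)
  δ q := {q' | ∃ c ∈ i.prog.cmds, View.Step c (toView i q) (toView i q')}
  ext b := {q | (toView i q).bool b = true}

theorem card_le_base :
    2 * Fintype.card (Fin i.prog.sig.nx) ≤ base i.code ∧
      2 * Fintype.card (YTerm i.prog.sig) ≤ base i.code := by
  simp only [Fintype.card_fin, Fintype.card_sum, Fintype.card_prod, base, dim, nb_code, nx_code,
    ny_code, na_code]
  rw [mul_comm i.prog.sig.nx]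
  omega

theorem toView_lt (q : ℕ) : (∀ x, (toView i q).dataX x < base i.code) ∧
    ∀ t, (toView i q).term t < base i.code := by
  have h : 0 < base i.code := by simp [base]
  refine ⟨fun x => Nat.mod_lt _ h, ?_⟩
  rintro (y | ax) <;> exact Nat.mod_lt _ h

theorem exists_toView_pattern_eq {α β : Type*} (v : View i.prog.sig α β) :
    ∃ q < size i.code, v.pattern = (toView i q).pattern := by
  obtain ⟨eX, hX, hXr⟩ := exists_injective_lt (fun _ : Fin i.prog.sig.nx => 0) card_le_base.1
  obtain ⟨eT, hT, hTr⟩ := exists_injective_lt (fun _ : YTerm i.prog.sig => 0) card_le_base.2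
  obtain ⟨w, hw, hwX, hwT⟩ := v.exists_copy hX hT
  obtain ⟨q, hq, rfl⟩ := exists_toView_eq w
    (fun x => by obtain ⟨j, hj⟩ := hwX x; rw [← hj]; exact (hXr j).1)
    (fun t => by obtain ⟨j, hj⟩ := hwT t; rw [← hj]; exact (hTr j).1)
  exact ⟨q, hq, hw⟩

theorem isBisimMap_system :
    IsBisimMap (system i) i.prog.patternSystem fun q : Fin (size i.code) =>
      (toView i q).pattern := by
  refine isBisimMap_pattern (S := system i) (fun q : Fin (size i.code) => toView i q)
    (fun _ _ => Iff.rfl) (fun _ _ h => h) ?_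
  intro (q : Fin (size i.code)) c hc v v' hv hs
  obtain ⟨eX, hX, hXr⟩ := exists_injective_lt (toView i q).dataX card_le_base.1
  obtain ⟨eT, hT, hTr⟩ := exists_injective_lt (toView i q).term card_le_base.2
  obtain ⟨w, hw, hstep, hwX, hwT⟩ := View.exists_step_copy (v' := v') hv hX
    (fun j => (hXr j).2) hT (fun j => (hTr j).2)
  obtain ⟨q', hq', rfl⟩ := exists_toView_eq w
    (by
      intro x
      obtain ⟨j, hj⟩ | ⟨j, hj⟩ := hwX x <;> rw [← hj]
      exacts [(toView_lt q).1 j, (hXr j).1])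
    (by
      intro t
      obtain ⟨j, hj⟩ | ⟨j, hj⟩ := hwT t <;> rw [← hj]
      exacts [(toView_lt q).2 j, (hTr j).1])
  exact ⟨(⟨q', hq'⟩ : Fin (size i.code)), ⟨c, hc, hstep c hs⟩, hw⟩

theorem step_iff (q q' : Fin (size i.code)) : Step i.code q q' ↔ q' ∈ (system i).δ q := by
  have hent : ∀ j (hj : j < i.prog.cmds.length), ent (cmds i.code) j = i.prog.cmds[j].code := by
    intro j hj
    simp [ent, hj]
  simp only [Step, entries_cmds_code, List.length_map]
  constructor
  · rintro ⟨j, hj, h⟩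
    rw [hent j hj, commandStep_code] at h
    exact ⟨_, List.getElem_mem hj, h⟩
  · rintro ⟨c, hc, h⟩
    obtain ⟨j, hj, rfl⟩ := List.getElem_of_mem hc
    exact ⟨j, hj, by rwa [hent j hj, commandStep_code]⟩

/-! ### Truth of formulas -/

/-- The assignment of sets of views to the fixpoint variables coded by `E`. -/
def toEnv (i : Problem) (E h : ℕ) : Set (system i).Q :=
  {q : Fin (size i.code) | Bit i.code E h q}

theorem bit_index_lt {n h q : ℕ} (hh : h < numVars n) (hq : q < size n) :
    h * size n + q < numVars n * size n :=
  calc h * size n + q < (h + 1) * size n := by rw [add_one_mul]; omega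
    _ ≤ numVars n * size n := Nat.mul_le_mul_right _ hh

theorem not_bit {n E h q : ℕ} (hE : E < envSize n) (hh : numVars n ≤ h) : ¬ Bit n E h q := by
  rw [Bit, digit_eq_zero_of_lt two_pos hE
    ((Nat.mul_le_mul_right _ hh).trans (Nat.le_add_right _ _))]
  norm_num

/-- Assignments are updated within the bound `envSize`, to any set of views. -/
theorem exists_toEnv_eq_update {E h : ℕ} (hE : E < envSize i.code) (hh : h < numVars i.code)
    (τ : Set (system i).Q) :
    ∃ E' < envSize i.code, toEnv i E' = Function.update (toEnv i E) h τ := by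
  have hpos : 0 < size i.code := Nat.pow_pos (by simp [base])
  obtain ⟨E', hE', hbit⟩ := exists_bits_iff (n := numVars i.code * size i.code) fun j =>
    (⟨j % size i.code, Nat.mod_lt _ hpos⟩ : Fin (size i.code)) ∈
      Function.update (toEnv i E) h τ (j / size i.code)
  refine ⟨E', hE', funext fun k => ?_⟩
  by_cases hk : k < numVars i.code
  · refine Set.ext fun (q : Fin (size i.code)) => ?_
    change Bit i.code E' k q ↔ _
    rw [Bit, hbit _ (bit_index_lt hk q.2)]
    have h1 : (k * size i.code + q) / size i.code = k := by
      rw [mul_comm, Nat.mul_add_div hpos, Nat.div_eq_of_lt q.2, add_zero]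
    have h2 : (k * size i.code + q) % size i.code = q := by
      rw [mul_comm, Nat.mul_add_mod, Nat.mod_eq_of_lt q.2]
    simp only [h1, h2]
    rfl
  · have hkh : k ≠ h := by omega
    rw [Function.update_of_ne hkh]
    ext q
    exact iff_of_false (not_bit hE' (not_lt.1 hk)) (not_bit hE (not_lt.1 hk))

theorem isFixUpdate_iff {R : ℕ → ℕ → Prop} {E h E' : ℕ} (hE : E < envSize i.code)
    (hE' : E' < envSize i.code) {τ : Set (system i).Q}
    (hR : ∀ q : Fin (size i.code), R E' q ↔ q ∈ τ) :
    IsFixUpdate i.code R E h E' ↔ toEnv i E' = Function.update (toEnv i E) h τ := by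
  constructor
  · rintro ⟨h1, h2⟩
    funext k
    by_cases hk : k = h
    · subst hk
      rw [Function.update_self]
      exact Set.ext fun (q : Fin (size i.code)) => (h2 _ q.2).trans (hR q)
    · rw [Function.update_of_ne hk]
      refine Set.ext fun (q : Fin (size i.code)) => ?_
      by_cases hlt : k < numVars i.code
      · exact (h1 k hlt _ q.2).resolve_left hk
      · exact iff_of_false (not_bit hE' (not_lt.1 hlt)) (not_bit hE (not_lt.1 hlt))
  · intro H
    constructor
    · intro k _ q hq
      by_cases hk : k = h
      · exact Or.inl hk
      · have := congrFun H k
        rw [Function.update_of_ne hk] at this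
        exact Or.inr (Set.ext_iff.1 this (⟨q, hq⟩ : Fin (size i.code)))
    · intro q hq
      have := congrFun H h
      rw [Function.update_self] at this
      exact (Set.ext_iff.1 this (⟨q, hq⟩ : Fin (size i.code))).trans (hR ⟨q, hq⟩).symm

theorem index_lt_index {n c c' E E' q q' : ℕ} (hc : c' < c) (hE : E' < envSize n)
    (hq : q' < size n) : index n c' E' q' < index n c E q :=
  calc index n c' E' q' < (c' * envSize n + E' + 1) * size n := by
        rw [index, add_one_mul (c' * envSize n + E')]; omega
    _ ≤ (c * envSize n + E) * size n := by
        refine Nat.mul_le_mul_right _ ?_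
        have : (c' + 1) * envSize n ≤ c * envSize n := Nat.mul_le_mul_right _ hc
        rw [add_one_mul] at this
        omega
    _ ≤ index n c E q := Nat.le_add_right _ _

theorem sem_iff {n c E q : ℕ} (hE : E < envSize n) (hq : q < size n) :
    sem n c E q = true ↔ SemClause n (fun c' E' q' =>
      c' < c ∧ E' < envSize n ∧ q' < size n ∧ sem n c' E' q' = true) c E q := by
  classical
  have hq0 : 0 < size n := by omega
  have hE0 : 0 < envSize n := by omega
  have h1 : index n c E q % size n = q := by
    rw [index, mul_comm, Nat.mul_add_mod, Nat.mod_eq_of_lt hq]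
  have h2 : index n c E q / size n = c * envSize n + E := by
    rw [index, mul_comm, Nat.mul_add_div hq0, Nat.div_eq_of_lt hq, add_zero]
  have h3 : (c * envSize n + E) % envSize n = E := by
    rw [mul_comm, Nat.mul_add_mod, Nat.mod_eq_of_lt hE]
  have h4 : (c * envSize n + E) / envSize n = c := by
    rw [mul_comm, Nat.mul_add_div hE0, Nat.div_eq_of_lt hE, add_zero]
  rw [sem, course, decide_eq_true_iff, length_courseList, h1, h2, h3, h4]
  refine iff_of_eq (congrArg (fun R => SemClause n R c E q) ?_)
  funext c' E' q'
  refine propext (and_congr_right fun hc' => and_congr_right fun hE' => and_congr_right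
    fun hq' => ?_)
  rw [getD_courseList _ _ (index_lt_index hc' hE' hq')]
  rfl

theorem sem_code (ψ : Formula (Fin i.prog.sig.nb)) :
    ∀ {E : ℕ}, ψ.code < numVars i.code → E < envSize i.code → ∀ q : Fin (size i.code),
      (sem i.code ψ.code E q = true ↔ q ∈ ψ.sem (system i) (toEnv i E)) := by
  have lt_pair : ∀ {k r : ℕ}, 0 < k → r < Nat.pair k r :=
    fun hk => by have := Nat.add_le_pair; grind
  induction ψ with
  | obs p =>
    intro E hψ hE q
    rw [sem_iff hE q.2]
    simp only [SemClause, Formula.code, Nat.unpair_pair]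
    norm_num
    exact (decide_eq_true_iff (p := bool i.code q p = 1)).symm
  | nobs p =>
    intro E hψ hE q
    rw [sem_iff hE q.2]
    simp only [SemClause, Formula.code, Nat.unpair_pair]
    norm_num
    exact not_congr (decide_eq_true_iff (p := bool i.code q p = 1)).symm
  | var h =>
    intro E hψ hE q
    rw [sem_iff hE q.2]
    simp only [SemClause, Formula.code, Nat.unpair_pair]
    norm_num
    rfl
  | or φ ψ ih₁ ih₂ =>
    intro E hψ hE q
    have h1 : φ.code < Nat.pair 3 (Nat.pair φ.code ψ.code) :=
      (Nat.left_le_pair _ _).trans_lt (lt_pair (by norm_num))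
    have h2 : ψ.code < Nat.pair 3 (Nat.pair φ.code ψ.code) :=
      (Nat.right_le_pair _ _).trans_lt (lt_pair (by norm_num))
    rw [sem_iff hE q.2]
    simp only [SemClause, Formula.code, Nat.unpair_pair, h1, h2, hE, q.2, true_and,
      ih₁ (h1.trans hψ) hE, ih₂ (h2.trans hψ) hE]
    norm_num
    rfl
  | and φ ψ ih₁ ih₂ =>
    intro E hψ hE q
    have h1 : φ.code < Nat.pair 4 (Nat.pair φ.code ψ.code) :=
      (Nat.left_le_pair _ _).trans_lt (lt_pair (by norm_num))
    have h2 : ψ.code < Nat.pair 4 (Nat.pair φ.code ψ.code) :=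
      (Nat.right_le_pair _ _).trans_lt (lt_pair (by norm_num))
    rw [sem_iff hE q.2]
    simp only [SemClause, Formula.code, Nat.unpair_pair, h1, h2, hE, q.2, true_and,
      ih₁ (h1.trans hψ) hE, ih₂ (h2.trans hψ) hE]
    norm_num
    rfl
  | ex φ ih =>
    intro E hψ hE q
    have h1 : φ.code < Nat.pair 5 φ.code := lt_pair (by norm_num)
    rw [sem_iff hE q.2]
    simp only [SemClause, Formula.code, Nat.unpair_pair, h1, hE, true_and]
    norm_num
    constructor
    · rintro ⟨q', hq', hs, -, h⟩
      exact ⟨(⟨q', hq'⟩ : Fin (size i.code)), (step_iff q ⟨q', hq'⟩).1 hs,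
        (ih (h1.trans hψ) hE ⟨q', hq'⟩).1 h⟩
    · rintro ⟨q', hs, h⟩
      exact ⟨_, Fin.is_lt _, (step_iff q q').2 hs, Fin.is_lt _, (ih (h1.trans hψ) hE q').2 h⟩
  | all φ ih =>
    intro E hψ hE q
    have h1 : φ.code < Nat.pair 6 φ.code := lt_pair (by norm_num)
    rw [sem_iff hE q.2]
    simp only [SemClause, Formula.code, Nat.unpair_pair, h1, hE, true_and, ← imp_iff_not_or]
    norm_num
    constructor
    · intro h q' hs
      exact (ih (h1.trans hψ) hE q').1 (h _ (Fin.is_lt _) ((step_iff q q').2 hs)).2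
    · intro h q' hq' hs
      exact ⟨hq', (ih (h1.trans hψ) hE ⟨q', hq'⟩).2 (h _ ((step_iff q ⟨q', hq'⟩).1 hs))⟩
  | mu h φ ih =>
    intro E hψ hE q
    have h1 : φ.code < Nat.pair 7 (Nat.pair h φ.code) :=
      (Nat.right_le_pair _ _).trans_lt (lt_pair (by norm_num))
    have h2 : h < Nat.pair 7 (Nat.pair h φ.code) :=
      (Nat.left_le_pair _ _).trans_lt (lt_pair (by norm_num))
    have fix : ∀ E' < envSize i.code, IsFixUpdate i.code (fun E' q' =>
        E' < envSize i.code ∧ q' < size i.code ∧ sem i.code φ.code E' q' = true) E h E' ↔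
          toEnv i E' = Function.update (toEnv i E) h (φ.sem (system i) (toEnv i E')) :=
      fun E' hE' => isFixUpdate_iff hE hE' fun q' => by
        simp only [hE', q'.2, true_and, ih (h1.trans hψ) hE']
    rw [sem_iff hE q.2]
    simp only [SemClause, Formula.code, Nat.unpair_pair, h1, true_and, ← imp_iff_not_or]
    norm_num
    constructor
    · intro H τ hτ
      obtain ⟨E', hE', hupd⟩ := exists_toEnv_eq_update hE (h2.trans hψ) τ
      have hq : q ∈ toEnv i E' h := H E' hE' ((fix E' hE').2 (by rw [hupd, ← hτ]))
      rwa [hupd, Function.update_self] at hq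
    · intro H E' hE' hfix
      have hupd := (fix E' hE').1 hfix
      have hq : q ∈ φ.sem (system i) (toEnv i E') := H _ (congrArg (φ.sem (system i)) hupd)
      change q ∈ toEnv i E' h
      rwa [hupd, Function.update_self]
  | nu h φ ih =>
    intro E hψ hE q
    have h1 : φ.code < Nat.pair 8 (Nat.pair h φ.code) :=
      (Nat.right_le_pair _ _).trans_lt (lt_pair (by norm_num))
    have h2 : h < Nat.pair 8 (Nat.pair h φ.code) :=
      (Nat.left_le_pair _ _).trans_lt (lt_pair (by norm_num))
    have fix : ∀ E' < envSize i.code, IsFixUpdate i.code (fun E' q' =>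
        E' < envSize i.code ∧ q' < size i.code ∧ sem i.code φ.code E' q' = true) E h E' ↔
          toEnv i E' = Function.update (toEnv i E) h (φ.sem (system i) (toEnv i E')) :=
      fun E' hE' => isFixUpdate_iff hE hE' fun q' => by
        simp only [hE', q'.2, true_and, ih (h1.trans hψ) hE']
    rw [sem_iff hE q.2]
    simp only [SemClause, Formula.code, Nat.unpair_pair, h1, true_and]
    norm_num
    constructor
    · rintro ⟨E', hE', hfix, hq⟩
      have hupd := (fix E' hE').1 hfix
      refine ⟨φ.sem (system i) (toEnv i E'), congrArg (φ.sem (system i)) hupd, ?_⟩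
      change q ∈ toEnv i E' h at hq
      rwa [hupd, Function.update_self] at hq
    · rintro ⟨τ, hτ, hq⟩
      obtain ⟨E', hE', hupd⟩ := exists_toEnv_eq_update hE (h2.trans hψ) τ
      refine ⟨E', hE', (fix E' hE').2 (by rw [hupd, ← hτ]), ?_⟩
      change q ∈ toEnv i E' h
      rwa [hupd, Function.update_self]

theorem accepts_code_iff : Accepts i.code ↔
    ∀ v : View i.prog.sig ℕ ℕ, v.Coherent → v.bool i.b₀ = true →
      v.pattern ∈ i.φ.sem i.prog.patternSystem fun _ => ∅ := by
  have hE : 0 < envSize i.code := Nat.pow_pos two_pos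
  have henv : toEnv i 0 = fun _ => ∅ := by
    funext h
    ext q
    refine iff_of_false ?_ (Set.notMem_empty _)
    change ¬ digit 2 0 _ = 1
    simp [digit]
  have key : ∀ q : Fin (size i.code), sem i.code (form i.code) 0 q = true ↔
      (toView i q).pattern ∈ i.φ.sem i.prog.patternSystem fun _ => ∅ := by
    intro q
    rw [form_code, sem_code i.φ (by simp [numVars]) hE q, henv]
    exact Set.ext_iff.1 (isBisimMap_system.mem_sem i.φ fun _ => ∅) q
  simp only [Accepts, ← imp_iff_not_or, coherent_iff, and_imp]
  constructor
  · intro h v hv hb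
    obtain ⟨q, hq, hvq⟩ := exists_toView_pattern_eq v
    rw [hvq, ← key ⟨q, hq⟩]
    refine h q hq (View.coherent_congr hvq hv) ?_
    have := congrFun (View.pattern_eq_iff.1 hvq).1 i.b₀
    rw [hb] at this
    simpa [toView] using this.symm
  · intro h q hq hc hb
    exact (key ⟨q, hq⟩).2 (h _ hc (by simpa [toView] using hb))

end Input

theorem Problem.holds_iff_accepts (i : Problem) (A B : Type*) [Infinite A] [Infinite B] :
    i.Holds A B ↔ Input.Accepts i.code :=
  (i.prog.sat_pfSem_iff A B i.b₀ i.closed).trans Input.accepts_code_iff.symm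

end ArrayMC

theorem mainTheorem1 :
    (∀ (A : Type*) (B : Type*) [Infinite A] [Infinite B],
      ArrayMC.DecidableProblem fun i => i.Holds A B) ∧
    (∀ (i : ArrayMC.Problem) (A : Type*) (B : Type*) (A' : Type*) (B' : Type*)
      [Infinite A] [Infinite B] [Infinite A'] [Infinite B'],
      i.Holds A B ↔ i.Holds A' B') := by
  classical
  refine ⟨fun A B _ _ => ⟨fun n => decide (ArrayMC.Input.Accepts n), ?_, fun i => ?_⟩,
    fun i A B A' B' _ _ _ _ => ?_⟩
  · exact ArrayMC.Input.primrecPred_accepts.decide.to_comp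
  · change _ ↔ i.Holds A B
    rw [decide_eq_true_iff, i.holds_iff_accepts]
  · rw [i.holds_iff_accepts, i.holds_iff_accepts]
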